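/- Conventions. All alphabets are finite. For an alphabet $\Lambda$, Turing machines have input alphabet $\{0,1\}$ and output alphabet $\Lambda$; an oracle machine has in addition a one-way read-only oracle tape carrying a sequence $\alpha\in\Theta^{\mathbb N}$, and $M^{\alpha}(u)$ denotes its output on input $u\in\{0,1\}^*$. A Turing machine (oracle machine) $U$ is universal if for every Turing machine (oracle machine) $M$ with the same alphabets there is a word $w$ such that, for every input $u$ (and every oracle $\alpha$), $U$ halts on $wu$ if and only if $M$ halts on $u$, with the same output. For a universal $U$, $C(v)$ (respectively $C(v|\alpha)$) is the length of a shortest input on which $U$ (with oracle $\alpha$) outputs the word $v$. For $\omega\in\Lambda^{\mathbb N}$, $\overline{\mathcal C}(\omega)$ and $\underline{\mathcal C}(\omega)$ are the $\limsup$ and $\liminf$ of $\frac1n C(\omega_0\cdots\omega_{n-1})$ as $n\to\infty$, and $\overline{\mathcal C}(\omega|\alpha)$, $\underline{\mathcal C}(\omega|\alpha)$ are the $\limsup$ and $\liminf$ of $\frac1n C(\omega_0\cdots\omega_{n-1}|\alpha)$. Setting. Let $\Theta$ be an alphabet, $\Xi=\Theta^{\mathbb N}$ with the $\sigma$-algebra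 generated by the cylinder sets, $\sigma$ the shift on $\Xi$, and $\nu$ a $\sigma$-invariant ergodic probability measure on $\Xi$. Let $(X,\mu)$ be a standard probability space and $(T_\theta)_{\theta\in\Theta}$ a family of $\mu$-preserving transformations of $X$. Let $T(\alpha,x)=(\sigma\alpha,T_{\alpha_0}x)$ be the skew product on $\Xi\times X$, which preserves $\nu\otimes\mu$; the system $(\Xi\times X,\nu\otimes\mu,T)$ is called a finite bundle RDS, and it is called ergodic if $T$ is ergodic with respect to $\nu\otimes\mu$. Let $\mathcal P$ be a finite partition of $X$, that is, a finite collection of a.s. disjoint measurable sets of positive measure that cover $X$ up to a null set, and let $\mathcal N$ be the partition of $\Xi$ into the cylinder sets $\{\alpha:\alpha_0=\theta\}$, $\theta\in\Theta$. For $\nu\otimes\mu$-almost every $(\alpha,x)$ there are a unique sequence $\tau$ over $\mathcal N\times\mathcal P$ with $T^n(\alpha,x)\in\tau_n$ for all $n\ge 0$ (the $\mathcal N\times\mathcal P$-name of $(\alpha,x)$) and a unique sequence $\omega$ over $\mathcal P$ with $T_{\alpha_{n-1}}\circ\dots\circ T_{\alpha_0}(x)\in\omega_n$ for all $n\ge 0$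 (the $\mathcal P$-$\alpha$-name of $x$). Write $\overline{\mathcal C}_{\mathcal N\times\mathcal P}(\alpha,x)=\overline{\mathcal C}(\tau)$ and $\overline{\mathcal C}_{\mathcal P}(x|\alpha)=\overline{\mathcal C}(\omega|\alpha)$, and similarly for the lower complexities. Theorem. Let $(\Xi\times X,\nu\otimes\mu,T)$ be an ergodic finite bundle RDS and let $\mathcal P$ be a finite partition of $X$. Then, for any choice of the universal machines, for $\nu\otimes\mu$-almost every $(\alpha,x)$ the names above exist and are unique, $$\overline{\mathcal C}_{\mathcal N\times\mathcal P}(\alpha,x)=\underline{\mathcal C}_{\mathcal N\times\mathcal P}(\alpha,x),\qquad \overline{\mathcal C}_{\mathcal P}(x|\alpha)=\underline{\mathcal C}_{\mathcal P}(x|\alpha),\qquad \overline{\mathcal C}(\alpha)=\underline{\mathcal C}(\alpha),$$ all these values are finite, and the common values $\mathcal C_{\mathcal N\times\mathcal P}(\alpha,x)$, $\mathcal C_{\mathcal P}(x|\alpha)$ and $\mathcal C(\alpha)$ satisfy $$\mathcal C_{\mathcal P}(x|\alpha)=\mathcal C_{\mathcal N\times\mathcal P}(\alpha,x)-\mathcal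 C(\alpha).$$ -/

import Mathlib

open MeasureTheory Filter
open scoped ENNReal NNReal

/-! ## Turing machines and oracle machines -/

/-- What a machine does in one step of a computation: it changes to the state `next`, writes
`write` on the current cell of the work tape (`none` is the blank), possibly moves the head of the
work tape, possibly prints a symbol on the output tape (and moves on to the next output cell), and
possibly moves the heads of the input tape and of the oracle tape one cell to the right. -/
structure MachineAction (Q Γ Λ : Type*) where
  next : Q
  write : Option Γ
  moveWork : Option Turing.Dir
  print : Option Λ
  moveInput : Bool
  moveOracle : Bool

/-- An oracle machine with input alphabet `{0,1}`, oracle alphabet `Θ` and output alphabet `Λ`.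
It has finitely many states and work symbols. The programme `step` determines the action out of the
current state, the scanned input symbol (`none` beyond the end of the input word), the scanned work
symbol (`none` is the blank) and the scanned oracle symbol; the value `none` means that the machine
stops. -/
structure OracleMachine (Θ Λ : Type*) where
  State : Type
  WorkSymbol : Type
  [finState : Finite State]
  [finWorkSymbol : Finite WorkSymbol]
  start : State
  step : State → Option Bool → Option WorkSymbol → Θ → Option (MachineAction State WorkSymbol Λ)

namespace OracleMachine

variable {Θ Λ : Type*}

/-- A configuration of an oracle machine: the current state, the unread part of the input tape
(starting with the scanned cell), the bi-infinite work tape, the part of the oracle tape from the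
scanned cell on, and the word printed on the output tape so far. -/
structure Cfg (M : OracleMachine Θ Λ) where
  state : M.State
  input : List Bool
  work : Turing.Tape (Option M.WorkSymbol)
  oracle : ℕ → Θ
  output : List Λ

/-- The configuration that results from performing an action. -/
def act (M : OracleMachine Θ Λ) (a : MachineAction M.State M.WorkSymbol Λ) (c : M.Cfg) : M.Cfg where
  state := a.next
  input := if a.moveInput then c.input.tail else c.input
  work := match a.moveWork with
    | none => c.work.write a.write
    | some d => (c.work.write a.write).move d
  oracle := if a.moveOracle then fun n => c.oracle (n + 1) else c.oracle
  output := c.output ++ a.print.toList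

/-- One step of the computation; `none` if the machine has stopped. -/
def next (M : OracleMachine Θ Λ) (c : M.Cfg) : Option M.Cfg :=
  (M.step c.state c.input.head? c.work.head (c.oracle 0)).map fun a => M.act a c

/-- The initial configuration with oracle `α` and input word `u`; the work tape is blank. -/
def init (M : OracleMachine Θ Λ) (α : ℕ → Θ) (u : List Bool) : M.Cfg where
  state := M.start
  input := u
  work := Turing.Tape.mk₁ []
  oracle := α
  output := []

/-- The output word `M^α(u)` of the machine `M` with oracle `α` on the input word `u`; it is defined
if and only if `M` stops on `u` when provided with the oracle `α`. -/
def eval (M : OracleMachine Θ Λ) (α : ℕ → Θ) (u : List Bool) : Part (List Λ) :=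
  (StateTransition.eval M.next (M.init α u)).map Cfg.output

/-- A universal oracle machine: for every oracle machine `M` there is a word `w` such that for all
oracles `α` the machine `U` stops on `wu` if and only if `M` stops on `u`, with the same output. -/
def IsUniversal (U : OracleMachine Θ Λ) : Prop :=
  ∀ M : OracleMachine Θ Λ, ∃ w : List Bool, ∀ (α : ℕ → Θ) (u : List Bool),
    U.eval α (w ++ u) = M.eval α u

/-- The conditional complexity `C_M(v|α)`: the length of a shortest input word on which `M` with
oracle `α` outputs `v`, and `∞` if there is none. -/
noncomputable def condComplexity (M : OracleMachine Θ Λ) (v : List Λ) (α : ℕ → Θ) : ℕ∞ :=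
  ⨅ u ∈ {u : List Bool | v ∈ M.eval α u}, (u.length : ℕ∞)

/-- The upper conditional algorithmic complexity of the sequence `ω` relative to `α`. -/
noncomputable def upperCondComplexity (U : OracleMachine Θ Λ) (ω : ℕ → Λ) (α : ℕ → Θ) : ℝ≥0∞ :=
  limsup (fun n : ℕ => (U.condComplexity ((List.range n).map ω) α : ℝ≥0∞) / n) atTop

/-- The lower conditional algorithmic complexity of the sequence `ω` relative to `α`. -/
noncomputable def lowerCondComplexity (U : OracleMachine Θ Λ) (ω : ℕ → Λ) (α : ℕ → Θ) : ℝ≥0∞ :=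
  liminf (fun n : ℕ => (U.condComplexity ((List.range n).map ω) α : ℝ≥0∞) / n) atTop

end OracleMachine

/-- An ordinary Turing machine with input alphabet `{0,1}` and output alphabet `Λ`: the oracle tape
carries a one-letter alphabet, so that the action depends only on the state and on the scanned input
and work symbols. `IsUniversal` then is universality among ordinary Turing machines. -/
abbrev TuringMachine (Λ : Type*) := OracleMachine Unit Λ

namespace TuringMachine

variable {Λ : Type*}

/-- The complexity `C_M(v)` of a word `v` with respect to the Turing machine `M`. -/
noncomputable def complexity (M : TuringMachine Λ) (v : List Λ) : ℕ∞ :=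
  M.condComplexity v fun _ => ()

/-- The upper algorithmic complexity of the sequence `ω`. -/
noncomputable def upperComplexity (U : TuringMachine Λ) (ω : ℕ → Λ) : ℝ≥0∞ :=
  limsup (fun n : ℕ => (complexity U ((List.range n).map ω) : ℝ≥0∞) / n) atTop

/-- The lower algorithmic complexity of the sequence `ω`. -/
noncomputable def lowerComplexity (U : TuringMachine Λ) (ω : ℕ → Λ) : ℝ≥0∞ :=
  liminf (fun n : ℕ => (complexity U ((List.range n).map ω) : ℝ≥0∞) / n) atTop

end TuringMachine

/-! ## Finite bundle random dynamical systems -/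

section RDS

variable {Θ X ι : Type*}

/-- The shift map on `Θ^ℕ`. -/
def seqShift (α : ℕ → Θ) : ℕ → Θ := fun n => α (n + 1)

/-- The step skew product `(α, x) ↦ (σ α, T_{α₀} x)`. -/
def skewProduct (T : Θ → X → X) (p : (ℕ → Θ) × X) : (ℕ → Θ) × X :=
  (seqShift p.1, T (p.1 0) p.2)

/-- `fiberIterate T α n` is `T_{α_{n-1}} ∘ ⋯ ∘ T_{α₀}`. -/
def fiberIterate (T : Θ → X → X) (α : ℕ → Θ) : ℕ → X → X
  | 0 => id
  | n + 1 => T (α n) ∘ fiberIterate T α n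

/-- `(Θ^ℕ × X, ν ⊗ μ, T)` is a finite bundle RDS: `ν` is invariant and ergodic under the shift, and
every `T_θ` preserves `μ`. -/
structure IsFiniteBundleRDS [MeasurableSpace Θ] [MeasurableSpace X]
    (ν : Measure (ℕ → Θ)) (μ : Measure X) (T : Θ → X → X) : Prop where
  base_ergodic : Ergodic seqShift ν
  fiber_preserving : ∀ θ, MeasurePreserving (T θ) μ μ

/-- A finite partition: finitely many a.s. disjoint measurable sets of positive measure that cover
the space up to a null set. -/
structure IsFinitePartition [MeasurableSpace X] (μ : Measure X) (P : ι → Set X) : Prop where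
  finite : Finite ι
  measurableSet : ∀ i, MeasurableSet (P i)
  pos : ∀ i, 0 < μ (P i)
  aedisjoint : Pairwise fun i j => AEDisjoint μ (P i) (P j)
  cover : ∀ᵐ x ∂μ, ∃ i, x ∈ P i

/-- The natural partition of `Θ^ℕ` into the cylinder sets specified in the first symbol. -/
def naturalPartition (θ : Θ) : Set (ℕ → Θ) := {α | α 0 = θ}

/-- The partition `𝒩 × 𝒫` of `Θ^ℕ × X`, with cells indexed by pairs. -/
def naturalProd (P : ι → Set X) (q : Θ × ι) : Set ((ℕ → Θ) × X) :=
  naturalPartition q.1 ×ˢ P q.2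

/-- `ω` is the unique sequence of (indices of) cells with `Sⁿ(y) ∈ Q (ω n)` for all `n`,
i.e. the `Q`-name of `y` under `S`. -/
def IsName {Y κ : Type*} (S : Y → Y) (Q : κ → Set Y) (y : Y) (ω : ℕ → κ) : Prop :=
  (∀ n, S^[n] y ∈ Q (ω n)) ∧ ∀ ω' : ℕ → κ, (∀ n, S^[n] y ∈ Q (ω' n)) → ω' = ω

/-- `ω` is the unique sequence of (indices of) cells with `T_{α_{n-1}} ∘ ⋯ ∘ T_{α₀} (x) ∈ P (ω n)`
for all `n`, i.e. the `P`-`α`-name of `x`. -/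
def IsFiberName (T : Θ → X → X) (P : ι → Set X) (α : ℕ → Θ) (x : X) (ω : ℕ → ι) : Prop :=
  (∀ n, fiberIterate T α n x ∈ P (ω n)) ∧
    ∀ ω' : ℕ → ι, (∀ n, fiberIterate T α n x ∈ P (ω' n)) → ω' = ω

end RDS

/-! Push `ν.prod μ` forward along the joint name map. The image `m` is a stationary ergodic measure
on sequences of pairs whose first marginal is `ν`. The two complexities without oracle are then
given by Brudno's theorem: they equal the entropy rates h(m) and h(ν), divided by log 2. What
remains is that the conditional complexity is almost surely (h(m) - h(ν)) / log 2.

Upper bounds come from coding. Given a block a of the oracle, a block v of the fibre name is encoded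
by a prefix-free word of about log₂ (P(a) / P(a,v)) bits, and for long blocks the mean number of
bits per letter tends to (h(m) - h(ν)) / log 2 (`exists_blockCode`). A finite transducer decodes
such words (`mem_eval_blockDecoder`). Since powers of the shift need not be ergodic, the code
lengths are averaged over all offsets of the block grid (`exists_condComplexity_le_sum`); this
leaves a Birkhoff sum of the shift itself.

Lower bounds come from counting. For each oracle at most 2^(q+1) words have complexity at most q, so
by Borel-Cantelli the complexity cannot stay below the conditional information
(`eventually_le_condComplexity_of_wordProb_le`). Here the oracle is the whole sequence α, whereas
the information is relative to the first n letters of α. This makes no difference, because the first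
n letters of the fibre name depend on α only through those letters, and x is independent of α
(`isNonanticipating_map_jointName`).

To turn information into entropy, the Shannon-McMillan-Breiman theorem is needed for `m` in one
direction and for `ν` in the other. For `eventually_wordProb_le_exp` the probability of a word is
compared with the product of the conditional probabilities of its letters given everything that
follows, to which the ergodic theorem applies. The opposite bound `eventually_exp_le_wordProb` is a
consequence of coding and counting together: words of too small probability would have a complexity
above the coding bound. The unconditional statements are the case of a one-letter oracle alphabet.
-/

set_option linter.unusedSectionVars false

/-! ### One-sided ergodic theorems from the maximal inequality -/

section Birkhoff

open Topology

variable {Ω : Type*} [MeasurableSpace Ω] {m : Measure Ω} {S : Ω → Ω} {f : Ω → ℝ}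

/-- The running maximum of the Birkhoff sums `0, f, f + f ∘ S, …` of order at most `n`. -/
def maxBirkhoff (S : Ω → Ω) (f : Ω → ℝ) : ℕ → Ω → ℝ
  | 0 => fun _ => 0
  | n + 1 => fun x => max 0 (f x + maxBirkhoff S f n (S x))

lemma maxBirkhoff_nonneg (n : ℕ) (x : Ω) : 0 ≤ maxBirkhoff S f n x := by
  cases n with
  | zero => exact le_rfl
  | succ n => exact le_max_left _ _

lemma maxBirkhoff_le_succ (n : ℕ) (x : Ω) : maxBirkhoff S f n x ≤ maxBirkhoff S f (n + 1) x := by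
  induction n generalizing x with
  | zero => exact maxBirkhoff_nonneg _ _
  | succ n ih => exact max_le_max le_rfl (by linarith [ih (S x)])

lemma birkhoffSum_le_maxBirkhoff (n : ℕ) (x : Ω) : birkhoffSum S f n x ≤ maxBirkhoff S f n x := by
  induction n generalizing x with
  | zero => simp [maxBirkhoff]
  | succ n ih =>
    rw [birkhoffSum_succ']
    exact le_max_of_le_right (by linarith [ih (S x)])

lemma measurable_maxBirkhoff (hS : Measurable S) (hf : Measurable f) (n : ℕ) :
    Measurable (maxBirkhoff S f n) := by
  induction n with
  | zero => exact measurable_const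
  | succ n ih => exact measurable_const.max (hf.add (ih.comp hS))

lemma integrable_maxBirkhoff [IsFiniteMeasure m] (hS : MeasurePreserving S m m)
    (hf : Integrable f m) (n : ℕ) : Integrable (maxBirkhoff S f n) m := by
  induction n with
  | zero => exact integrable_const _
  | succ n ih =>
    exact (integrable_const (0 : ℝ)).sup (hf.add (hS.integrable_comp_of_integrable ih))

/-- The maximal ergodic inequality. -/
lemma setIntegral_maxBirkhoff_nonneg [IsFiniteMeasure m] (hS : MeasurePreserving S m m)
    (hfm : Measurable f) (hf : Integrable f m) (n : ℕ) :
    0 ≤ ∫ x in {x | 0 < maxBirkhoff S f n x}, f x ∂m := by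
  cases n with
  | zero => simp [maxBirkhoff]
  | succ n =>
    have hms : MeasurableSet {x | 0 < maxBirkhoff S f (n + 1) x} :=
      measurableSet_lt measurable_const (measurable_maxBirkhoff hS.measurable hfm _)
    have hi := integrable_maxBirkhoff hS hf (n + 1)
    have hi' : Integrable (fun x => maxBirkhoff S f (n + 1) (S x)) m :=
      hS.integrable_comp_of_integrable hi
    rw [← integral_indicator hms]
    have h0 : ∫ x, (maxBirkhoff S f (n + 1) x - maxBirkhoff S f (n + 1) (S x)) ∂m = 0 := by
      rw [integral_sub hi hi', sub_eq_zero]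
      have := integral_map (μ := m) hS.aemeasurable (f := maxBirkhoff S f (n + 1))
        (by rw [hS.map_eq]; exact hi.aestronglyMeasurable)
      rw [hS.map_eq] at this
      exact this
    -- Garsia's argument. Where the maximum of order `n + 1` is positive, it equals `f` plus the
    -- maximum of order `n` at `S x`, which is at most the maximum of order `n + 1` there; elsewhere
    -- it vanishes, and the subtracted term is nonnegative.
    refine h0.symm.le.trans (integral_mono (hi.sub hi') (hf.indicator hms) fun x => ?_)
    by_cases hx : 0 < maxBirkhoff S f (n + 1) x
    · simp only [Set.indicator, Set.mem_ofPred_eq, hx, if_true]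
      have h1 : maxBirkhoff S f (n + 1) x = f x + maxBirkhoff S f n (S x) := by
        have h2 : maxBirkhoff S f (n + 1) x = max 0 (f x + maxBirkhoff S f n (S x)) := rfl
        rcases max_choice 0 (f x + maxBirkhoff S f n (S x)) with h | h
        · rw [h2, h] at hx; exact absurd hx (lt_irrefl _)
        · rw [h2, h]
      linarith [maxBirkhoff_le_succ (S := S) (f := f) n (S x)]
    · simp only [Set.indicator, Set.mem_ofPred_eq, hx, if_false]
      linarith [maxBirkhoff_nonneg (S := S) (f := f) (n + 1) (S x)]

/-- The Birkhoff sums of a function with negative mean are almost surely bounded above. -/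
lemma Ergodic.birkhoffSum_bddAbove [IsProbabilityMeasure m] (hS : Ergodic S m)
    (hfm : Measurable f) (hf : Integrable f m) (hneg : ∫ x, f x ∂m < 0) :
    ∀ᵐ x ∂m, ∃ K, ∀ n, birkhoffSum S f n x ≤ K := by
  -- Unboundedness of the running maxima is a strictly invariant event, so it is null or conull. If
  -- it were conull, the sets of the maximal inequality would exhaust the space, and the mean of `f`
  -- would be nonnegative.
  set E : Set Ω := {x | ∀ K : ℕ, ∃ n, (K : ℝ) < maxBirkhoff S f n x} with hE
  have hEm : MeasurableSet E := by
    have : E = ⋂ K : ℕ, ⋃ n, {x | (K : ℝ) < maxBirkhoff S f n x} := by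
      ext x; simp [hE]
    rw [this]
    exact MeasurableSet.iInter fun K => MeasurableSet.iUnion fun n =>
      measurableSet_lt measurable_const (measurable_maxBirkhoff hS.measurable hfm _)
  have hEinv : S ⁻¹' E = E := by
    ext x
    simp only [hE, Set.mem_preimage, Set.mem_ofPred_eq]
    constructor
    · intro h K
      obtain ⟨K', hK'⟩ := exists_nat_gt (K - f x)
      obtain ⟨n, hn⟩ := h K'
      refine ⟨n + 1, lt_of_lt_of_le ?_ (le_max_right _ _)⟩
      linarith
    · intro h K
      obtain ⟨K', hK'⟩ := exists_nat_gt (|K + f x|)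
      obtain ⟨n, hn⟩ := h K'
      cases n with
      | zero =>
        have : (0 : ℝ) ≤ K' := Nat.cast_nonneg _
        simp only [maxBirkhoff] at hn
        linarith
      | succ n =>
        refine ⟨n, ?_⟩
        rcases lt_max_iff.1 hn with h1 | h1
        · have : (0 : ℝ) ≤ K' := Nat.cast_nonneg _
          linarith
        · linarith [le_abs_self ((K : ℝ) + f x)]
  rcases hS.toPreErgodic.ae_mem_or_ae_notMem hEm hEinv with h | h
  · exfalso
    have hlim : Tendsto (fun n => ∫ x in {x | 0 < maxBirkhoff S f n x}, f x ∂m) atTop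
        (𝓝 (∫ x, f x ∂m)) := by
      have hms : ∀ n, MeasurableSet {x | 0 < maxBirkhoff S f n x} := fun n =>
        measurableSet_lt measurable_const (measurable_maxBirkhoff hS.measurable hfm _)
      simp_rw [← integral_indicator (hms _)]
      refine tendsto_integral_of_dominated_convergence (fun x => ‖f x‖)
        (fun n => (hf.indicator (hms n)).aestronglyMeasurable) hf.norm
        (fun n => ae_of_all _ fun x => norm_indicator_le_norm_self _ _) ?_
      filter_upwards [h] with x hx
      obtain ⟨n, hn⟩ := hx 0
      refine tendsto_const_nhds.congr' ?_
      filter_upwards [eventually_ge_atTop n] with k hk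
      have hmono : Monotone fun n => maxBirkhoff S f n x :=
        monotone_nat_of_le_succ fun n => maxBirkhoff_le_succ n x
      have : 0 < maxBirkhoff S f k x := by
        have := hmono hk
        simp only [Nat.cast_zero] at hn
        exact lt_of_lt_of_le hn this
      simp [Set.indicator, this]
    have := ge_of_tendsto' hlim fun n =>
      setIntegral_maxBirkhoff_nonneg hS.toMeasurePreserving hfm hf n
    linarith
  · filter_upwards [h] with x hx
    simp only [hE, Set.mem_ofPred_eq, not_forall, not_exists, not_lt] at hx
    obtain ⟨K, hK⟩ := hx
    exact ⟨K, fun n => (birkhoffSum_le_maxBirkhoff n x).trans (hK n)⟩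

/-- After subtraction of a constant `d` strictly between the mean and `c`, the sums are bounded
above, and the slack `(c - d) * n` eventually exceeds the bound. -/
lemma Ergodic.birkhoffSum_eventually_le [IsProbabilityMeasure m] (hS : Ergodic S m)
    (hfm : Measurable f) (hf : Integrable f m) {c : ℝ} (hc : ∫ x, f x ∂m < c) :
    ∀ᵐ x ∂m, ∀ᶠ n : ℕ in atTop, birkhoffSum S f n x ≤ c * n := by
  obtain ⟨d, hd, hdc⟩ := exists_between hc
  have h := hS.birkhoffSum_bddAbove (f := fun x => f x - d) (hfm.sub measurable_const)
    (hf.sub (integrable_const _)) (by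
      rw [integral_sub hf (integrable_const _)]; simp; exact hd)
  filter_upwards [h] with x ⟨K, hK⟩
  have hev : ∀ᶠ n : ℕ in atTop, K ≤ (c - d) * n :=
    (tendsto_natCast_atTop_atTop.const_mul_atTop (sub_pos.2 hdc)).eventually_ge_atTop K
  filter_upwards [hev] with n hn
  have := hK n
  have e : birkhoffSum S (fun x => f x - d) n x = birkhoffSum S f n x - n * d := by
    simp [birkhoffSum, Finset.sum_sub_distrib]
  rw [e] at this
  linarith

lemma Ergodic.le_birkhoffSum_eventually [IsProbabilityMeasure m] (hS : Ergodic S m)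
    (hfm : Measurable f) (hf : Integrable f m) {c : ℝ} (hc : c < ∫ x, f x ∂m) :
    ∀ᵐ x ∂m, ∀ᶠ n : ℕ in atTop, c * n ≤ birkhoffSum S f n x := by
  have h := hS.birkhoffSum_eventually_le (f := fun x => -f x) hfm.neg hf.neg (c := -c)
    (by rw [integral_neg]; linarith)
  filter_upwards [h] with x hx
  filter_upwards [hx] with n hn
  have e : birkhoffSum S (fun x => -f x) n x = -birkhoffSum S f n x := by
    simp [birkhoffSum]
  rw [e] at hn
  linarith

end Birkhoff

/-! ### Entropy rate as the conditional entropy of the first letter given all later ones -/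

section Entropy

open Topology Real

variable {A : Type*} [MeasurableSpace A] [DiscreteMeasurableSpace A]

/-- The word consisting of the first `n` letters of a sequence. -/
def initialWord (n : ℕ) (x : ℕ → A) : Fin n → A := fun i => x i

lemma measurable_initialWord (n : ℕ) : Measurable (initialWord (A := A) n) :=
  measurable_pi_lambda _ fun _ => measurable_pi_apply _

lemma measurable_seqShift : Measurable (seqShift (Θ := A)) :=
  measurable_pi_lambda _ fun _ => measurable_pi_apply _

lemma initialWord_succ_eq_cons_iff {n : ℕ} {x : ℕ → A} {a : A} {w : Fin n → A} :
    initialWord (n + 1) x = Fin.cons a w ↔ x 0 = a ∧ initialWord n (seqShift x) = w := by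
  constructor
  · intro h
    refine ⟨by simpa [initialWord] using congrFun h 0, ?_⟩
    funext i
    simpa [initialWord, seqShift] using congrFun h i.succ
  · rintro ⟨h0, h⟩
    funext i
    refine Fin.cases ?_ (fun j => ?_) i
    · simpa [initialWord] using h0
    · simpa [initialWord, seqShift] using congrFun h j

lemma initialWord_succ_cylinder {n : ℕ} (a : A) (w : Fin n → A) :
    initialWord (n + 1) ⁻¹' {(Fin.cons a w : Fin (n + 1) → A)} =
      seqShift ⁻¹' (initialWord n ⁻¹' {w}) ∩ {x | x 0 = a} := by
  ext x
  simp only [Set.mem_preimage, Set.mem_singleton_iff, initialWord_succ_eq_cons_iff, Set.mem_inter_iff,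
    Set.mem_ofPred_eq]
  exact and_comm

lemma measurableSet_head_eq (a : A) : MeasurableSet {x : ℕ → A | x 0 = a} :=
  (measurable_pi_apply (X := fun _ : ℕ => A) 0) (measurableSet_singleton a)

/-- The probability of the cylinder set specified by the word `w`. -/
noncomputable def wordProb (m : Measure (ℕ → A)) {n : ℕ} (w : Fin n → A) : ℝ :=
  m.real (initialWord n ⁻¹' {w})

/-- The part of the measure where the first letter is `a`, transported by the shift. -/
noncomputable def letterMeasure (m : Measure (ℕ → A)) (a : A) : Measure (ℕ → A) :=
  (m.restrict {x | x 0 = a}).map seqShift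

/-- The conditional probability that the first letter is `a`, as a function of the sequence of the
other letters. -/
noncomputable def letterDensity (m : Measure (ℕ → A)) (a : A) (x : ℕ → A) : ℝ≥0∞ :=
  min 1 ((letterMeasure m a).rnDeriv m x)

/-- The entropy of the word formed by the first `n` letters. -/
noncomputable def blockEntropy [Fintype A] (m : Measure (ℕ → A)) (n : ℕ) : ℝ :=
  ∑ w : Fin n → A, negMulLog (wordProb m w)

/-- The entropy of the first letter conditioned on the sequence of the other letters. -/
noncomputable def entropyRate [Fintype A] (m : Measure (ℕ → A)) : ℝ :=
  ∫ x, ∑ a, negMulLog (letterDensity m a x).toReal ∂m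

variable {m : Measure (ℕ → A)} [IsProbabilityMeasure m]

lemma wordProb_nonneg {n : ℕ} (w : Fin n → A) : 0 ≤ wordProb m w := measureReal_nonneg

lemma integral_comp_initialWord [Fintype A] {n : ℕ} (φ : (Fin n → A) → ℝ) :
    ∫ x, φ (initialWord n x) ∂m = ∑ w, wordProb m w * φ w := by
  have : IsProbabilityMeasure (m.map (initialWord n)) :=
    Measure.isProbabilityMeasure_map (measurable_initialWord n).aemeasurable
  rw [← integral_map (measurable_initialWord n).aemeasurable (f := φ)
    (measurable_of_finite φ).aestronglyMeasurable, integral_fintype Integrable.of_finite]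
  refine Finset.sum_congr rfl fun w _ => ?_
  rw [map_measureReal_apply (measurable_initialWord n) (measurableSet_singleton _)]
  rfl

lemma sum_wordProb [Fintype A] (n : ℕ) : ∑ w : Fin n → A, wordProb m w = 1 := by
  have := integral_comp_initialWord (m := m) (n := n) fun _ => 1
  simpa using this.symm

lemma letterMeasure_le (hm : MeasurePreserving seqShift m m) (a : A) : letterMeasure m a ≤ m := by
  have := Measure.map_mono (Measure.restrict_le_self (μ := m) (s := {x | x 0 = a})) measurable_seqShift
  rwa [hm.map_eq] at this

instance (a : A) : IsFiniteMeasure (letterMeasure m a) :=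
  Measure.isFiniteMeasure_map _ _

lemma letterMeasure_absolutelyContinuous (hm : MeasurePreserving seqShift m m) (a : A) :
    letterMeasure m a ≪ m := (letterMeasure_le hm a).absolutelyContinuous

/-- Since `letterMeasure m a ≤ m`, the cut-off at 1 in `letterDensity` alters the Radon-Nikodym
derivative only on a null set. Its purpose is to make the bounds below hold everywhere. -/
lemma letterDensity_ae_eq (hm : MeasurePreserving seqShift m m) (a : A) :
    letterDensity m a =ᵐ[m] (letterMeasure m a).rnDeriv m := by
  filter_upwards [Measure.rnDeriv_le_one_of_le (letterMeasure_le hm a)] with x hx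
  exact min_eq_right hx

lemma measurable_letterDensity (a : A) : Measurable (letterDensity m a) :=
  measurable_const.min (Measure.measurable_rnDeriv _ _)

lemma letterDensity_le_one (a : A) (x : ℕ → A) : letterDensity m a x ≤ 1 := min_le_left _ _

lemma letterDensity_ne_top (a : A) (x : ℕ → A) : letterDensity m a x ≠ ∞ :=
  ((letterDensity_le_one a x).trans_lt ENNReal.one_lt_top).ne

lemma toReal_letterDensity_le_one (a : A) (x : ℕ → A) : (letterDensity m a x).toReal ≤ 1 := by
  have := ENNReal.toReal_mono ENNReal.one_ne_top (letterDensity_le_one (m := m) a x)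
  simpa using this

lemma letterMeasure_real_cylinder {n : ℕ} (a : A) (w : Fin n → A) :
    (letterMeasure m a).real (initialWord n ⁻¹' {w}) =
      wordProb m (Fin.cons a w : Fin (n + 1) → A) := by
  have h1 : MeasurableSet (initialWord n ⁻¹' {w}) :=
    measurable_initialWord n (measurableSet_singleton w)
  rw [letterMeasure, map_measureReal_apply measurable_seqShift h1,
    measureReal_restrict_apply (measurable_seqShift h1), wordProb, initialWord_succ_cylinder]

lemma sum_wordProb_cons [Fintype A] (hm : MeasurePreserving seqShift m m) {n : ℕ} (w : Fin n → A) :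
    ∑ a, wordProb m (Fin.cons a w : Fin (n + 1) → A) = wordProb m w := by
  have h1 : MeasurableSet (initialWord n ⁻¹' {w}) :=
    measurable_initialWord n (measurableSet_singleton w)
  have h2 : wordProb m w = m.real (seqShift ⁻¹' (initialWord n ⁻¹' {w})) := by
    rw [hm.measureReal_preimage h1.nullMeasurableSet]; rfl
  rw [h2]
  have h4 : seqShift ⁻¹' (initialWord n ⁻¹' {w}) =
      ⋃ a, initialWord (n + 1) ⁻¹' {(Fin.cons a w : Fin (n + 1) → A)} := by
    ext x
    simp [initialWord_succ_cylinder]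
  rw [h4, measureReal_iUnion_fintype]
  · rfl
  · intro a b hab
    refine Disjoint.preimage _ (Set.disjoint_singleton.2 fun h => hab ?_)
    simpa using congrFun h 0
  · exact fun a => measurable_initialWord _ (measurableSet_singleton _)

lemma wordProb_cons_le [Fintype A] (hm : MeasurePreserving seqShift m m) {n : ℕ} (a : A)
    (w : Fin n → A) : wordProb m (Fin.cons a w : Fin (n + 1) → A) ≤ wordProb m w := by
  rw [← sum_wordProb_cons hm w]
  exact Finset.single_le_sum (f := fun a => wordProb m (Fin.cons a w : Fin (n + 1) → A))
    (fun _ _ => wordProb_nonneg _) (Finset.mem_univ a)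

/-- The filtration generated by the coordinates. -/
def wordFiltration (A : Type*) [MeasurableSpace A] [DiscreteMeasurableSpace A] :
    Filtration ℕ (MeasurableSpace.pi : MeasurableSpace (ℕ → A)) where
  seq n := MeasurableSpace.comap (initialWord n) inferInstance
  mono' n k hnk := by
    rw [← measurable_iff_comap_le]
    have : initialWord (A := A) n = (fun w i => w (Fin.castLE hnk i)) ∘ initialWord k := rfl
    rw [this]
    exact (measurable_pi_lambda _ fun i => measurable_pi_apply _).comp (comap_measurable _)
  le' n := (measurable_initialWord n).comap_le

lemma iSup_wordFiltration : ⨆ n, wordFiltration A n = MeasurableSpace.pi := by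
  refine le_antisymm (iSup_le fun n => (wordFiltration A).le n) (iSup_le fun i => ?_)
  refine le_trans ?_ (le_iSup _ (i + 1))
  rw [← measurable_iff_comap_le]
  exact (measurable_pi_apply (⟨i, i.lt_succ_self⟩ : Fin (i + 1))).comp
    (comap_measurable (initialWord (i + 1)))

/-- Over the cylinder of a word `w`, both the quotient and the density integrate to the probability
of the word `a w`, and such cylinders generate the σ-algebra. -/
lemma condExp_letterDensity [Fintype A] (hm : MeasurePreserving seqShift m m) (a : A) (n : ℕ) :
    (fun x => wordProb m (Fin.cons a (initialWord n x) : Fin (n + 1) → A) /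
        wordProb m (initialWord n x)) =ᵐ[m]
      m[fun x => (letterDensity m a x).toReal | wordFiltration A n] := by
  have hr : (fun x => (letterDensity m a x).toReal) =ᵐ[m]
      fun x => ((letterMeasure m a).rnDeriv m x).toReal :=
    (letterDensity_ae_eq hm a).fun_comp ENNReal.toReal
  refine EventuallyEq.trans ?_ (condExp_congr_ae hr.symm)
  set φ : (Fin n → A) → ℝ := fun w => wordProb m (Fin.cons a w : Fin (n + 1) → A) / wordProb m w
    with hφ
  have hφm : Measurable[wordFiltration A n] fun x => φ (initialWord n x) :=
    (measurable_of_finite φ).comp (comap_measurable _)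
  have hφi : Integrable (fun x => φ (initialWord n x)) m := by
    have : IsProbabilityMeasure (m.map (initialWord n)) :=
      Measure.isProbabilityMeasure_map (measurable_initialWord n).aemeasurable
    exact (integrable_map_measure (measurable_of_finite φ).aestronglyMeasurable
      (measurable_initialWord n).aemeasurable).1 Integrable.of_finite
  refine ae_eq_condExp_of_forall_setIntegral_eq ((wordFiltration A).le n)
    Measure.integrable_toReal_rnDeriv (fun s _ _ => hφi.integrableOn) ?_
    hφm.stronglyMeasurable.aestronglyMeasurable
  rintro s ⟨t, -, rfl⟩ -
  rw [Measure.setIntegral_toReal_rnDeriv (letterMeasure_absolutelyContinuous hm a)]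
  have hts : MeasurableSet (initialWord n ⁻¹' t) := measurable_initialWord n t.toFinite.measurableSet
  rw [← integral_indicator hts]
  have h1 : (fun x => (initialWord n ⁻¹' t).indicator (fun x => φ (initialWord n x)) x) =
      fun x => t.indicator φ (initialWord n x) := by
    funext x; rfl
  rw [h1, integral_comp_initialWord]
  have h2 : (letterMeasure m a).real (initialWord n ⁻¹' t) =
      ∑ w, t.indicator (fun w => wordProb m (Fin.cons a w : Fin (n + 1) → A)) w := by
    classical
    have h3 : initialWord n ⁻¹' t = ⋃ w ∈ t.toFinset, initialWord n ⁻¹' {w} := by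
      ext x; simp
    rw [h3, measureReal_biUnion_finset]
    · simp_rw [letterMeasure_real_cylinder]
      rw [← Finset.sum_indicator_subset _ (Finset.subset_univ t.toFinset)]
      simp
    · intro v _ w _ hvw
      exact Disjoint.preimage _ (Set.disjoint_singleton.2 hvw)
    · exact fun w _ => measurable_initialWord n (measurableSet_singleton w)
  rw [h2]
  refine Finset.sum_congr rfl fun w _ => ?_
  by_cases hw : w ∈ t
  · simp only [Set.indicator, hw, if_true, hφ]
    -- Division by zero does no harm: a word of probability zero has only extensions of probability
    -- zero.
    by_cases h0 : wordProb m w = 0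
    · have := wordProb_cons_le hm a w
      have h5 := wordProb_nonneg (m := m) (Fin.cons a w : Fin (n + 1) → A)
      rw [h0, zero_mul]; linarith
    · field_simp
  · simp [Set.indicator, hw]

/-- Lévy's upward theorem: the quotients are conditional expectations of the density along a
filtration that exhausts the σ-algebra. -/
lemma tendsto_condProb [Fintype A] (hm : MeasurePreserving seqShift m m) (a : A) :
    ∀ᵐ x ∂m, Tendsto (fun n => wordProb m (Fin.cons a (initialWord n x) : Fin (n + 1) → A) /
        wordProb m (initialWord n x)) atTop (𝓝 (letterDensity m a x).toReal) := by
  have h1 := tendsto_ae_condExp (μ := m) (ℱ := wordFiltration A)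
    fun x => (letterDensity m a x).toReal
  have h2 : ∀ᵐ x ∂m, ∀ n, wordProb m (Fin.cons a (initialWord n x) : Fin (n + 1) → A) /
        wordProb m (initialWord n x) =
      (m[fun x => (letterDensity m a x).toReal | wordFiltration A n]) x :=
    ae_all_iff.2 fun n => condExp_letterDensity hm a n
  have hme : Measurable fun x => (letterDensity m a x).toReal :=
    (measurable_letterDensity a).ennreal_toReal
  have h3 : m[fun x => (letterDensity m a x).toReal | ⨆ n, wordFiltration A n] =
      fun x => (letterDensity m a x).toReal := by
    rw [iSup_wordFiltration]
    refine condExp_of_stronglyMeasurable le_rfl hme.stronglyMeasurable ?_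
    refine Integrable.of_bound hme.aestronglyMeasurable 1 (ae_of_all _ fun x => ?_)
    rw [Real.norm_of_nonneg ENNReal.toReal_nonneg]
    exact toReal_letterDensity_le_one a x
  rw [h3] at h1
  filter_upwards [h1, h2] with x hx1 hx2
  simp_rw [hx2]
  exact hx1

lemma abs_negMulLog_le_one {t : ℝ} (h0 : 0 ≤ t) (h1 : t ≤ 1) : |negMulLog t| ≤ 1 := by
  rw [abs_of_nonneg (negMulLog_nonneg h0 h1)]
  linarith [negMulLog_le_one_sub_self h0]

/-- The chain rule for entropy. The additional letter is put in front; stationarity ensures that the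
probabilities of the words `a w` still sum to that of `w`. -/
lemma blockEntropy_succ_sub [Fintype A] (hm : MeasurePreserving seqShift m m) (n : ℕ) :
    blockEntropy m (n + 1) - blockEntropy m n =
      ∫ x, ∑ a, negMulLog (wordProb m (Fin.cons a (initialWord n x) : Fin (n + 1) → A) /
        wordProb m (initialWord n x)) ∂m := by
  rw [integral_comp_initialWord (fun w => ∑ a, negMulLog
    (wordProb m (Fin.cons a w : Fin (n + 1) → A) / wordProb m w))]
  have h1 : blockEntropy m (n + 1) =
      ∑ w : Fin n → A, ∑ a, negMulLog (wordProb m (Fin.cons a w : Fin (n + 1) → A)) := by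
    rw [blockEntropy, ← (Fin.consEquiv fun _ : Fin (n + 1) => A).sum_comp, Fintype.sum_prod_type,
      Finset.sum_comm]
    rfl
  rw [h1, blockEntropy, ← Finset.sum_sub_distrib]
  refine Finset.sum_congr rfl fun w _ => ?_
  rw [Finset.mul_sum]
  by_cases h0 : wordProb m w = 0
  · have : ∀ a, wordProb m (Fin.cons a w : Fin (n + 1) → A) = 0 := fun a =>
      le_antisymm (h0 ▸ wordProb_cons_le hm a w) (wordProb_nonneg _)
    simp [h0, this]
  have h2 : negMulLog (wordProb m w) =
      ∑ a, -(wordProb m (Fin.cons a w : Fin (n + 1) → A) * log (wordProb m w)) := by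
    rw [Finset.sum_neg_distrib, ← Finset.sum_mul, sum_wordProb_cons hm, negMulLog]; ring
  rw [h2, ← Finset.sum_sub_distrib]
  refine Finset.sum_congr rfl fun a _ => ?_
  by_cases h3 : wordProb m (Fin.cons a w : Fin (n + 1) → A) = 0
  · simp [h3]
  · rw [negMulLog, negMulLog, log_div h3 h0]
    field_simp
    ring

/-- The increments of the block entropies converge to the entropy rate. -/
lemma tendsto_blockEntropy_succ_sub [Fintype A] (hm : MeasurePreserving seqShift m m) :
    Tendsto (fun n => blockEntropy m (n + 1) - blockEntropy m n) atTop (𝓝 (entropyRate m)) := by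
  simp_rw [blockEntropy_succ_sub hm]
  have hq : ∀ n (x : ℕ → A) a,
      0 ≤ wordProb m (Fin.cons a (initialWord n x) : Fin (n + 1) → A) / wordProb m (initialWord n x) ∧
      wordProb m (Fin.cons a (initialWord n x) : Fin (n + 1) → A) / wordProb m (initialWord n x) ≤ 1 :=
    fun n x a => ⟨div_nonneg (wordProb_nonneg _) (wordProb_nonneg _),
      div_le_one_of_le₀ (wordProb_cons_le hm _ _) (wordProb_nonneg _)⟩
  refine tendsto_integral_of_dominated_convergence (fun _ => Fintype.card A) (fun n => ?_)
    (integrable_const _) (fun n => ae_of_all _ fun x => ?_) ?_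
  · exact ((measurable_of_finite fun w : Fin n → A => ∑ a, negMulLog
      (wordProb m (Fin.cons a w : Fin (n + 1) → A) / wordProb m w)).comp
        (measurable_initialWord n)).aestronglyMeasurable
  · refine (norm_sum_le _ _).trans ?_
    refine (Finset.sum_le_card_nsmul _ _ 1 fun a _ => ?_).trans (by simp)
    exact abs_negMulLog_le_one (hq n x a).1 (hq n x a).2
  · filter_upwards [ae_all_iff.2 fun a => tendsto_condProb hm a] with x hx
    exact tendsto_finsetSum _ fun a _ => (continuous_negMulLog.tendsto _).comp (hx a)

/-- Cesàro means of the convergent increments telescope. -/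
lemma tendsto_blockEntropy_div [Fintype A] (hm : MeasurePreserving seqShift m m) :
    Tendsto (fun n : ℕ => blockEntropy m n / n) atTop (𝓝 (entropyRate m)) := by
  have h := (tendsto_blockEntropy_succ_sub hm).cesaro
  have h0 : blockEntropy m 0 = 0 := by
    have h1 : ∀ w : Fin 0 → A, wordProb m w = 1 := fun w => by
      have : initialWord (A := A) 0 ⁻¹' {w} = Set.univ := by
        ext x; simp [Subsingleton.elim (initialWord 0 x) w]
      rw [wordProb, this]; simp
    simp [blockEntropy, h1]
  refine h.congr fun n => ?_
  rw [Finset.sum_range_sub, h0, sub_zero, div_eq_inv_mul]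

end Entropy

/-! ### Exponential decay of cylinder probabilities, by comparison with products of conditional
densities -/

section LowerShannonMcMillanBreiman

open Topology Real

variable {A : Type*} [MeasurableSpace A] [DiscreteMeasurableSpace A]
  {m : Measure (ℕ → A)} [IsProbabilityMeasure m]

/-- The conditional probability of the first letter given all the other letters. -/
noncomputable def headDensity (m : Measure (ℕ → A)) (x : ℕ → A) : ℝ≥0∞ :=
  letterDensity m (x 0) (seqShift x)

/-- The conditional probability of the first `n` letters given all the other letters. -/
noncomputable def prefixDensity (m : Measure (ℕ → A)) : ℕ → (ℕ → A) → ℝ≥0∞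
  | 0 => fun _ => 1
  | n + 1 => fun x => headDensity m x * prefixDensity m n (seqShift x)

lemma measurable_headDensity [Fintype A] : Measurable (headDensity m) := by
  have h : Measurable fun p : A × (ℕ → A) => letterDensity m p.1 p.2 :=
    measurable_from_prod_countable_right fun a => measurable_letterDensity a
  exact h.comp ((measurable_pi_apply (X := fun _ : ℕ => A) 0).prodMk measurable_seqShift)

lemma measurable_prefixDensity [Fintype A] (n : ℕ) : Measurable (prefixDensity m n) := by
  induction n with
  | zero => exact measurable_const
  | succ n ih => exact measurable_headDensity.mul (ih.comp measurable_seqShift)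

/-- Disintegration with respect to the tail: `letterDensity m a` is the density of the shifted
restriction `letterMeasure m a`. -/
lemma setLIntegral_head_eq (hm : MeasurePreserving seqShift m m) (a : A) {u : (ℕ → A) → ℝ≥0∞}
    (hu : Measurable u) :
    ∫⁻ x in {x | x 0 = a}, u (seqShift x) ∂m = ∫⁻ x, letterDensity m a x * u x ∂m := by
  have h1 : ∫⁻ x, letterDensity m a x * u x ∂m =
      ∫⁻ x, (letterMeasure m a).rnDeriv m x * u x ∂m := by
    refine lintegral_congr_ae ?_
    filter_upwards [letterDensity_ae_eq hm a] with x hx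
    rw [hx]
  rw [h1, lintegral_rnDeriv_mul (letterMeasure_absolutelyContinuous hm a) hu.aemeasurable,
    letterMeasure, lintegral_map hu measurable_seqShift]

lemma setIntegral_head_eq (hm : MeasurePreserving seqShift m m) (a : A) {u : (ℕ → A) → ℝ}
    (hu : Measurable u) :
    ∫ x in {x | x 0 = a}, u (seqShift x) ∂m = ∫ x, (letterDensity m a x).toReal * u x ∂m := by
  have h1 : ∫ x, (letterDensity m a x).toReal * u x ∂m =
      ∫ x, ((letterMeasure m a).rnDeriv m x).toReal * u x ∂m := by
    refine integral_congr_ae ?_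
    filter_upwards [letterDensity_ae_eq hm a] with x hx
    rw [hx]
  rw [h1, integral_toReal_rnDeriv_mul (letterMeasure_absolutelyContinuous hm a),
    letterMeasure, integral_map measurable_seqShift.aemeasurable hu.aestronglyMeasurable]

/-- Integrating out the first letter produces the factor `letterDensity`, which cancels the
reciprocal of the first factor of `prefixDensity`; then induct. Only an inequality survives, because
where the density vanishes the product of 0 and ∞ counts as 0. -/
lemma setLIntegral_inv_prefixDensity_le_one [Fintype A] (hm : MeasurePreserving seqShift m m)
    {n : ℕ} (w : Fin n → A) :
    ∫⁻ x in initialWord n ⁻¹' {w}, (prefixDensity m n x)⁻¹ ∂m ≤ 1 := by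
  induction n with
  | zero => simpa [prefixDensity] using prob_le_one
  | succ n ih =>
    have hC : MeasurableSet (initialWord n ⁻¹' {Fin.tail w}) :=
      measurable_initialWord n (measurableSet_singleton _)
    set u : (ℕ → A) → ℝ≥0∞ := (initialWord n ⁻¹' {Fin.tail w}).indicator
      fun y => (letterDensity m (w 0) y * prefixDensity m n y)⁻¹ with hu
    have hum : Measurable u :=
      ((measurable_letterDensity (w 0)).mul (measurable_prefixDensity n)).inv.indicator hC
    have h1 : ∫⁻ x in initialWord (n + 1) ⁻¹' {w}, (prefixDensity m (n + 1) x)⁻¹ ∂m =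
        ∫⁻ x in {x | x 0 = w 0}, u (seqShift x) ∂m := by
      have hw : w = (Fin.cons (w 0) (Fin.tail w) : Fin (n + 1) → A) := (Fin.cons_self_tail w).symm
      have h2 := initialWord_succ_cylinder (w 0) (Fin.tail w)
      rw [← hw] at h2
      rw [← lintegral_indicator (measurable_initialWord _ (measurableSet_singleton _)),
        ← lintegral_indicator (measurableSet_head_eq _), h2]
      refine lintegral_congr fun x => ?_
      by_cases hx0 : x 0 = w 0
      · by_cases hx1 : initialWord n (seqShift x) = Fin.tail w
        · simp [Set.indicator, hu, hx0, hx1, prefixDensity, headDensity]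
        · simp [Set.indicator, hu, hx1]
      · simp [Set.indicator, hx0]
    rw [h1, setLIntegral_head_eq hm _ hum]
    refine le_trans ?_ (ih (Fin.tail w))
    rw [← lintegral_indicator hC]
    refine lintegral_mono fun y => ?_
    by_cases hy : y ∈ initialWord n ⁻¹' {Fin.tail w}
    · simp only [hu, Set.indicator_of_mem hy]
      by_cases h0 : letterDensity m (w 0) y = 0
      · simp [h0]
      · have ht := letterDensity_ne_top (m := m) (w 0) y
        rw [ENNReal.mul_inv (Or.inl h0) (Or.inl ht), ← mul_assoc, ENNReal.mul_inv_cancel h0 ht,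
          one_mul]
    · simp only [hu, Set.indicator_of_notMem hy, mul_zero, le_refl]

lemma lintegral_wordProb_div_prefixDensity_le_one [Fintype A]
    (hm : MeasurePreserving seqShift m m) (n : ℕ) :
    ∫⁻ x, ENNReal.ofReal (wordProb m (initialWord n x)) * (prefixDensity m n x)⁻¹ ∂m ≤ 1 := by
  have hC : ∀ w : Fin n → A, MeasurableSet (initialWord n ⁻¹' {w}) := fun w =>
    measurable_initialWord n (measurableSet_singleton _)
  have hU : (Set.univ : Set (ℕ → A)) = ⋃ w : Fin n → A, initialWord n ⁻¹' {w} := by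
    ext x; simp
  rw [← setLIntegral_univ, hU, lintegral_iUnion hC
    fun v w hvw => Disjoint.preimage _ (Set.disjoint_singleton.2 hvw), tsum_fintype]
  calc ∑ w : Fin n → A, ∫⁻ x in initialWord n ⁻¹' {w},
        ENNReal.ofReal (wordProb m (initialWord n x)) * (prefixDensity m n x)⁻¹ ∂m
      = ∑ w : Fin n → A, ENNReal.ofReal (wordProb m w) *
          ∫⁻ x in initialWord n ⁻¹' {w}, (prefixDensity m n x)⁻¹ ∂m := by
        refine Finset.sum_congr rfl fun w _ => ?_
        rw [← lintegral_const_mul _ (f := fun x => (prefixDensity m n x)⁻¹)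
          (measurable_prefixDensity n).inv]
        refine setLIntegral_congr_fun (hC w) fun x hx => ?_
        have : initialWord n x = w := hx
        simp only [this]
    _ ≤ ∑ w : Fin n → A, ENNReal.ofReal (wordProb m w) * 1 :=
        Finset.sum_le_sum fun w _ =>
          mul_le_mul_right (setLIntegral_inv_prefixDensity_le_one hm w) _
    _ = 1 := by
        simp_rw [mul_one]
        rw [← ENNReal.ofReal_sum_of_nonneg fun w _ => wordProb_nonneg w, sum_wordProb,
          ENNReal.ofReal_one]

/-- The quotient of the two sides without the exponential has integral at most 1, so by Markov's
inequality it reaches `exp (δ * n)` with probability at most `exp (-δ * n)`; Borel-Cantelli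
concludes. -/
lemma eventually_wordProb_le_prefixDensity [Fintype A] (hm : MeasurePreserving seqShift m m)
    {δ : ℝ} (hδ : 0 < δ) :
    ∀ᵐ x ∂m, ∀ᶠ n : ℕ in atTop, ENNReal.ofReal (wordProb m (initialWord n x)) ≤
      ENNReal.ofReal (exp (δ * n)) * prefixDensity m n x := by
  set F : ℕ → (ℕ → A) → ℝ≥0∞ := fun n x =>
    ENNReal.ofReal (wordProb m (initialWord n x)) * (prefixDensity m n x)⁻¹ with hF
  have hFm : ∀ n, Measurable (F n) := fun n =>
    ((measurable_of_finite fun w : Fin n → A => ENNReal.ofReal (wordProb m w)).comp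
      (measurable_initialWord n)).mul (measurable_prefixDensity n).inv
  have hb : ∀ n : ℕ, m {x | ENNReal.ofReal (exp (δ * n)) ≤ F n x} ≤
      ENNReal.ofReal (exp (-δ) ^ n) := fun n => by
    have h := (mul_meas_ge_le_lintegral (hFm n) (ENNReal.ofReal (exp (δ * n)))).trans
      (lintegral_wordProb_div_prefixDensity_le_one hm n)
    have he : ENNReal.ofReal (exp (-δ) ^ n) = (ENNReal.ofReal (exp (δ * n)))⁻¹ := by
      rw [← ENNReal.ofReal_inv_of_pos (exp_pos _), ← exp_neg, ← exp_nat_mul]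
      ring_nf
    rw [he, ENNReal.le_inv_iff_mul_le, mul_comm]
    exact h
  have hsum : ∑' n : ℕ, m {x | ENNReal.ofReal (exp (δ * n)) ≤ F n x} ≠ ∞ := by
    refine ne_top_of_le_ne_top ?_ (ENNReal.tsum_le_tsum hb)
    rw [← ENNReal.ofReal_tsum_of_nonneg (fun n => by positivity)
      (summable_geometric_of_lt_one (exp_pos _).le (by rw [exp_lt_one_iff]; linarith))]
    exact ENNReal.ofReal_ne_top
  filter_upwards [ae_eventually_notMem hsum] with x hx
  filter_upwards [hx] with n hn
  simp only [not_le] at hn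
  have hpos : ENNReal.ofReal (exp (δ * n)) ≠ 0 := by simp [exp_pos]
  have h := hn.le
  simp only [hF, ← div_eq_mul_inv] at h
  exact (ENNReal.div_le_iff_le_mul (Or.inr ENNReal.ofReal_ne_top) (Or.inr hpos)).1 h

/-- The negative logarithm of `headDensity`, truncated at the level `M`. -/
noncomputable def truncInfo (m : Measure (ℕ → A)) (M : ℕ) (x : ℕ → A) : ℝ :=
  -log (max (headDensity m x).toReal (exp (-M)))

lemma truncInfo_nonneg (M : ℕ) (x : ℕ → A) : 0 ≤ truncInfo m M x := by
  rw [truncInfo, neg_nonneg]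
  refine log_nonpos (by positivity) (max_le (toReal_letterDensity_le_one _ _) ?_)
  rw [exp_le_one_iff]; simp

lemma truncInfo_le (M : ℕ) (x : ℕ → A) : truncInfo m M x ≤ M := by
  have h := log_le_log (exp_pos _) (le_max_right (headDensity m x).toReal (exp (-M)))
  rw [log_exp] at h
  rw [truncInfo]; linarith

lemma measurable_truncInfo [Fintype A] (M : ℕ) : Measurable (truncInfo m M) :=
  ((measurable_headDensity.ennreal_toReal.max measurable_const).log).neg

lemma integrable_truncInfo [Fintype A] (M : ℕ) : Integrable (truncInfo m M) m := by
  refine Integrable.of_bound (measurable_truncInfo M).aestronglyMeasurable M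
    (ae_of_all _ fun x => ?_)
  rw [Real.norm_of_nonneg (truncInfo_nonneg M x)]
  exact truncInfo_le M x

/-- Truncation can only enlarge the factors, so it respects the direction of the estimate while
making the summands bounded. -/
lemma prefixDensity_le_exp (M n : ℕ) (x : ℕ → A) :
    prefixDensity m n x ≤ ENNReal.ofReal (exp (-birkhoffSum seqShift (truncInfo m M) n x)) := by
  induction n generalizing x with
  | zero => simp [prefixDensity]
  | succ n ih =>
    rw [birkhoffSum_succ', neg_add, exp_add, ENNReal.ofReal_mul (exp_pos _).le]
    refine mul_le_mul' ?_ (ih _)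
    rw [truncInfo, neg_neg, exp_log (lt_max_of_lt_right (exp_pos _))]
    calc headDensity m x = ENNReal.ofReal (headDensity m x).toReal :=
          (ENNReal.ofReal_toReal (letterDensity_ne_top _ _)).symm
      _ ≤ _ := ENNReal.ofReal_le_ofReal (le_max_left _ _)

/-- Averaging over the first letter, given the others, turns the information into a sum over letters
weighted by their conditional probabilities. -/
lemma integral_truncInfo [Fintype A] (hm : MeasurePreserving seqShift m m) (M : ℕ) :
    ∫ x, truncInfo m M x ∂m = ∫ x, ∑ a, (letterDensity m a x).toReal *
      -log (max (letterDensity m a x).toReal (exp (-M))) ∂m := by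
  have hu : ∀ a, Measurable fun x => -log (max (letterDensity m a x).toReal (exp (-M))) := fun a =>
    ((measurable_letterDensity a).ennreal_toReal.max measurable_const).log.neg
  have hU : (Set.univ : Set (ℕ → A)) = ⋃ a : A, {x | x 0 = a} := by ext x; simp
  rw [← setIntegral_univ, hU, integral_iUnion_fintype measurableSet_head_eq
    (fun a b hab => Set.disjoint_left.2 fun x (hx : x 0 = a) (hx' : x 0 = b) => hab (hx ▸ hx'))
    (fun a => (integrable_truncInfo M).integrableOn), integral_finsetSum]
  · refine Finset.sum_congr rfl fun a _ => ?_
    rw [← setIntegral_head_eq hm a (hu a)]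
    refine setIntegral_congr_fun (measurableSet_head_eq a) fun x hx => ?_
    have : x 0 = a := hx
    simp only [truncInfo, headDensity, this]
  · intro a _
    refine Integrable.of_bound
      ((measurable_letterDensity a).ennreal_toReal.mul (hu a)).aestronglyMeasurable M
      (ae_of_all _ fun x => ?_)
    have h1 := toReal_letterDensity_le_one (m := m) a x
    have h2 : 0 ≤ -log (max (letterDensity m a x).toReal (exp (-M))) := by
      rw [neg_nonneg]
      refine log_nonpos (by positivity) (max_le h1 ?_)
      rw [exp_le_one_iff]; simp
    have h3 : -log (max (letterDensity m a x).toReal (exp (-M))) ≤ M := by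
      have h := log_le_log (exp_pos _) (le_max_right (letterDensity m a x).toReal (exp (-M)))
      rw [log_exp] at h
      linarith
    rw [norm_mul, Real.norm_of_nonneg ENNReal.toReal_nonneg, Real.norm_of_nonneg h2]
    exact (mul_le_of_le_one_left h2 h1).trans h3

/-- Each summand is dominated by `negMulLog t ≤ 1` and coincides with it as soon as `exp (-M) ≤ t`.
-/
lemma tendsto_integral_truncInfo [Fintype A] (hm : MeasurePreserving seqShift m m) :
    Tendsto (fun M => ∫ x, truncInfo m M x ∂m) atTop (𝓝 (entropyRate m)) := by
  simp_rw [integral_truncInfo hm]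
  refine tendsto_integral_of_dominated_convergence (fun _ => Fintype.card A) (fun M => ?_)
    (integrable_const _) (fun M => ae_of_all _ fun x => ?_) (ae_of_all _ fun x => ?_)
  · exact (Finset.measurable_sum _ fun a _ => (measurable_letterDensity a).ennreal_toReal.mul
      ((measurable_letterDensity a).ennreal_toReal.max
        measurable_const).log.neg).aestronglyMeasurable
  · refine (norm_sum_le _ _).trans ?_
    refine (Finset.sum_le_card_nsmul _ _ 1 fun a _ => ?_).trans (by simp)
    set t := (letterDensity m a x).toReal
    have h0 : 0 ≤ t := ENNReal.toReal_nonneg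
    have h1 : t ≤ 1 := toReal_letterDensity_le_one a x
    have h2 : 0 ≤ -log (max t (exp (-M))) := by
      rw [neg_nonneg]
      refine log_nonpos (by positivity) (max_le h1 ?_)
      rw [exp_le_one_iff]; simp
    rw [Real.norm_of_nonneg (mul_nonneg h0 h2)]
    rcases h0.eq_or_lt with h | h
    · rw [← h]; simp
    have h3 : t * -log (max t (exp (-M))) ≤ negMulLog t := by
      rw [negMulLog]
      have := log_le_log h (le_max_left t (exp (-M)))
      nlinarith
    exact h3.trans ((le_abs_self _).trans (abs_negMulLog_le_one h0 h1))
  · refine tendsto_finsetSum _ fun a _ => ?_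
    set t := (letterDensity m a x).toReal
    have h0 : 0 ≤ t := ENNReal.toReal_nonneg
    refine tendsto_const_nhds.congr' ?_
    rcases h0.eq_or_lt with h | h
    · refine Eventually.of_forall fun M => ?_
      rw [← h]; simp
    have hev : ∀ᶠ M : ℕ in atTop, -log t ≤ M :=
      tendsto_natCast_atTop_atTop.eventually_ge_atTop _
    filter_upwards [hev] with M hM
    have : exp (-M) ≤ t := by
      rw [← exp_log h, exp_le_exp]; linarith
    rw [max_eq_left this, negMulLog]; ring

/-- The lower bound of the Shannon-McMillan-Breiman theorem: the probability of the initial words of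
almost every sequence decays at least with the exponential rate given by the entropy. -/
theorem eventually_wordProb_le_exp [Fintype A] (hm : Ergodic seqShift m) {s : ℝ}
    (hs : s < entropyRate m) :
    ∀ᵐ x ∂m, ∀ᶠ n : ℕ in atTop, wordProb m (initialWord n x) ≤ exp (-(s * n)) := by
  -- The gap between `t` and the entropy rate pays for the truncation, the gap `t - s` for the
  -- subexponential error in the comparison with `prefixDensity`.
  obtain ⟨t, hst, ht⟩ := exists_between hs
  obtain ⟨M, hM⟩ :=
    ((tendsto_integral_truncInfo hm.toMeasurePreserving).eventually (lt_mem_nhds ht)).exists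
  filter_upwards [hm.le_birkhoffSum_eventually (measurable_truncInfo M) (integrable_truncInfo M) hM,
    eventually_wordProb_le_prefixDensity hm.toMeasurePreserving (sub_pos.2 hst)] with x h1 h2
  filter_upwards [h1, h2] with n hn1 hn2
  have h3 := hn2.trans (mul_le_mul_right (prefixDensity_le_exp M n x) _)
  rw [← ENNReal.ofReal_mul (exp_pos _).le, ← exp_add,
    ENNReal.ofReal_le_ofReal_iff (exp_pos _).le] at h3
  refine h3.trans (exp_le_exp.2 ?_)
  linarith

end LowerShannonMcMillanBreiman

namespace OracleMachine

variable {Θ Λ : Type*}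

/-! ### Few words have small complexity -/

section Counting

variable (M : OracleMachine Θ Λ)

lemma condComplexity_le_iff {v : List Λ} {α : ℕ → Θ} {k : ℕ} :
    M.condComplexity v α ≤ k ↔ ∃ u : List Bool, u.length ≤ k ∧ v ∈ M.eval α u := by
  constructor
  · intro h
    by_contra! hc
    have h1 : ((k + 1 : ℕ) : ℕ∞) ≤ M.condComplexity v α := by
      refine le_iInf₂ fun u hu => ?_
      have : ¬ u.length ≤ k := fun hk => hc u hk hu
      exact_mod_cast Nat.lt_of_not_le this
    have h2 := h1.trans h
    norm_cast at h2
    omega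
  · rintro ⟨u, hu, hv⟩
    exact (iInf₂_le u hv).trans (by exact_mod_cast hu)

lemma finite_and_ncard_boolLists_le (k : ℕ) :
    {u : List Bool | u.length ≤ k}.Finite ∧ {u : List Bool | u.length ≤ k}.ncard ≤ 2 ^ (k + 1) := by
  refine ⟨List.finite_length_le Bool k, ?_⟩
  induction k with
  | zero =>
    have : {u : List Bool | u.length ≤ 0} = {[]} := by ext u; simp
    rw [this]; simp
  | succ k ih =>
    have h1 : {u : List Bool | u.length ≤ k + 1} =
        {u : List Bool | u.length ≤ k} ∪ Set.range (List.ofFn : (Fin (k + 1) → Bool) → List Bool) := by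
      ext u
      simp only [Set.mem_union, Set.mem_ofPred_eq, Set.mem_range]
      constructor
      · intro h
        rcases h.lt_or_eq with h | h
        · exact Or.inl (Nat.lt_succ_iff.1 h)
        · exact Or.inr ⟨fun i => u.get (i.cast h.symm), by
            refine List.ext_getElem (by simp [h]) fun i _ _ => ?_
            rw [List.getElem_ofFn]; rfl⟩
      · rintro (h | ⟨f, rfl⟩)
        · omega
        · simp
    rw [h1]
    refine (Set.ncard_union_le _ _).trans ?_
    have h2 : (Set.range (List.ofFn : (Fin (k + 1) → Bool) → List Bool)).ncard ≤ 2 ^ (k + 1) := by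
      rw [← Set.image_univ]
      refine (Set.ncard_image_le Set.finite_univ).trans ?_
      simp [Set.ncard_univ]
    rw [pow_succ 2 (k + 1)]
    omega

/-- There are at most `2 ^ (k + 1)` words of complexity at most `k`. -/
lemma finite_and_ncard_condComplexity_le (α : ℕ → Θ) (k : ℕ) :
    {v : List Λ | M.condComplexity v α ≤ k}.Finite ∧
      {v : List Λ | M.condComplexity v α ≤ k}.ncard ≤ 2 ^ (k + 1) := by
  classical
  have hsub : {v : List Λ | M.condComplexity v α ≤ k} ⊆
      (fun u => if h : (M.eval α u).Dom then (M.eval α u).get h else []) ''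
        {u : List Bool | u.length ≤ k} := by
    intro v hv
    obtain ⟨u, hu, hd, hv'⟩ := M.condComplexity_le_iff.1 hv
    exact ⟨u, hu, by simp only [hd, dif_pos]; exact hv'⟩
  have hb := finite_and_ncard_boolLists_le k
  exact ⟨(hb.1.image _).subset hsub, (Set.ncard_le_ncard hsub (hb.1.image _)).trans
    ((Set.ncard_image_le hb.1).trans hb.2)⟩

end Counting

/-! ### Halting computations read finitely many oracle letters; measurability in the oracle -/

section FiniteUse

variable (M : OracleMachine Θ Λ)

/-- A step inspects the oracle only at the scanned position `j`. As a configuration stores the whole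
unread tail of the oracle, changing the oracle means replacing this tail. -/
lemma next_finiteUse {α : ℕ → Θ} {j : ℕ} {c c' : M.Cfg} (hc : c.oracle = fun n => α (n + j))
    (h : M.next c = some c') :
    ∃ j', c'.oracle = (fun n => α (n + j')) ∧ ∀ α' : ℕ → Θ, α' j = α j →
      M.next { c with oracle := fun n => α' (n + j) } =
        some { c' with oracle := fun n => α' (n + j') } := by
  obtain ⟨q, inp, wk, orc, out⟩ := c
  simp only at hc
  subst hc
  simp only [next, Option.map_eq_some_iff] at h
  obtain ⟨a, ha, rfl⟩ := h
  refine ⟨if a.moveOracle then j + 1 else j, ?_, fun α' hα' => ?_⟩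
  · cases hmo : a.moveOracle <;> simp [act, hmo, ← add_assoc, add_right_comm]
  · simp only [next, Nat.zero_add, hα'] at ha ⊢
    rw [ha]
    cases hmo : a.moveOracle <;> simp [act, hmo, ← add_assoc, add_right_comm]

lemma reaches_finiteUse {α : ℕ → Θ} {u : List Bool} {c : M.Cfg}
    (h : StateTransition.Reaches M.next (M.init α u) c) :
    ∃ N j, c.oracle = (fun n => α (n + j)) ∧ ∀ α' : ℕ → Θ, (∀ i < N, α' i = α i) →
      StateTransition.Reaches M.next (M.init α' u) { c with oracle := fun n => α' (n + j) } := by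
  induction h with
  | refl => exact ⟨0, 0, rfl, fun α' _ => Relation.ReflTransGen.refl⟩
  | @tail c c' _ hs ih =>
    obtain ⟨N, j, hj, hN⟩ := ih
    obtain ⟨j', hj', hn⟩ := M.next_finiteUse hj hs
    exact ⟨max N (j + 1), j', hj', fun α' hα' =>
      (hN α' fun i hi => hα' i (lt_max_of_lt_left hi)).tail
        (hn α' (hα' j (lt_max_of_lt_right j.lt_succ_self)))⟩

lemma mem_eval_iff {α : ℕ → Θ} {u : List Bool} {v : List Λ} :
    v ∈ M.eval α u ↔ ∃ c, StateTransition.Reaches M.next (M.init α u) c ∧ M.next c = none ∧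
      c.output = v := by
  simp only [eval, Part.mem_map_iff, StateTransition.mem_eval, and_assoc]

lemma eval_finiteUse {α : ℕ → Θ} {u : List Bool} {v : List Λ} (h : v ∈ M.eval α u) :
    ∃ N, ∀ α' : ℕ → Θ, (∀ i < N, α' i = α i) → v ∈ M.eval α' u := by
  obtain ⟨c, hr, hn, rfl⟩ := M.mem_eval_iff.1 h
  obtain ⟨N, j, hj, hN⟩ := M.reaches_finiteUse hr
  -- The letter at position `j` is also needed: the decision to stop depends on it.
  refine ⟨max N (j + 1), fun α' hα' => M.mem_eval_iff.2 ⟨_,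
    hN α' fun i hi => hα' i (lt_max_of_lt_left hi), ?_, rfl⟩⟩
  have h1 := hα' j (lt_max_of_lt_right j.lt_succ_self)
  simp only [next, Option.map_eq_none_iff, hj, Nat.zero_add] at hn
  simp only [next, Option.map_eq_none_iff, Nat.zero_add, h1, hn]

/-- Such a set is a union of cylinders, and there are only countably many cylinders. -/
lemma measurableSet_of_finiteUse [Finite Θ] [MeasurableSpace Θ] [DiscreteMeasurableSpace Θ]
    {D : Set (ℕ → Θ)}
    (hD : ∀ α ∈ D, ∃ N, ∀ α' : ℕ → Θ, (∀ i < N, α' i = α i) → α' ∈ D) : MeasurableSet D := by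
  have h : D = ⋃ p : {p : Σ N, Fin N → Θ // initialWord p.1 ⁻¹' {p.2} ⊆ D},
      initialWord p.1.1 ⁻¹' {p.1.2} := by
    ext α
    simp only [Set.mem_iUnion]
    constructor
    · intro hα
      obtain ⟨N, hN⟩ := hD α hα
      refine ⟨⟨⟨N, initialWord N α⟩, fun α' hα' => hN α' fun i hi => ?_⟩, rfl⟩
      exact congrFun (Set.mem_singleton_iff.1 hα') ⟨i, hi⟩
    · rintro ⟨p, hp⟩
      exact p.2 hp
  rw [h]
  exact MeasurableSet.iUnion fun p => measurable_initialWord _ (measurableSet_singleton _)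

lemma measurableSet_condComplexity_le [Finite Θ] [MeasurableSpace Θ] [DiscreteMeasurableSpace Θ]
    (v : List Λ) (k : ℕ) : MeasurableSet {α : ℕ → Θ | M.condComplexity v α ≤ k} := by
  refine measurableSet_of_finiteUse fun α hα => ?_
  obtain ⟨u, hu, hv⟩ := M.condComplexity_le_iff.1 hα
  obtain ⟨N, hN⟩ := M.eval_finiteUse hv
  exact ⟨N, fun α' hα' => M.condComplexity_le_iff.2 ⟨u, hu, hN α' hα'⟩⟩

end FiniteUse

end OracleMachine

/-! ### Finite transducers as oracle machines -/

namespace OracleMachine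

/-- The oracle machine without work tape whose programme is given by the transition function `δ` on
a finite set of states. A transition specifies the next state, the printed symbol, and whether the
heads of the input and the oracle tape move. -/
noncomputable def ofTransducer {Θ Λ Q : Type*} [Finite Q]
    (δ : Q → Option Bool → Θ → Option (Q × Option Λ × Bool × Bool)) (q₀ : Q) :
    OracleMachine Θ Λ where
  -- The states of a machine live in `Type`, whereas `Q` may lie in any universe; hence the
  -- enumeration.
  State := Fin (Nat.card Q)
  WorkSymbol := Empty
  start := Finite.equivFin Q q₀
  step q β _ θ := (δ ((Finite.equivFin Q).symm q) β θ).map fun r =>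
    { next := Finite.equivFin Q r.1
      write := none
      moveWork := none
      print := r.2.1
      moveInput := r.2.2.1
      moveOracle := r.2.2.2 }

section Transducer

variable {Θ Λ Q : Type*} [Finite Q]
  {δ : Q → Option Bool → Θ → Option (Q × Option Λ × Bool × Bool)} {q₀ : Q}

/-- The configuration of a transducer; the work tape is blank. -/
noncomputable def transducerCfg (δ : Q → Option Bool → Θ → Option (Q × Option Λ × Bool × Bool))
    (q₀ : Q) (q : Q) (u : List Bool) (α : ℕ → Θ) (v : List Λ) : (ofTransducer δ q₀).Cfg :=
  ⟨Finite.equivFin Q q, u, Turing.Tape.mk₁ [], α, v⟩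

lemma next_transducerCfg (q : Q) (u : List Bool) (α : ℕ → Θ) (v : List Λ) :
    (ofTransducer δ q₀).next (transducerCfg δ q₀ q u α v) =
      (δ q u.head? (α 0)).map fun r => transducerCfg δ q₀ r.1
        (if r.2.2.1 then u.tail else u) (if r.2.2.2 then fun n => α (n + 1) else α)
        (v ++ r.2.1.toList) := by
  simp only [next, transducerCfg, ofTransducer, Equiv.symm_apply_apply, Option.map_map]
  congr 1

end Transducer

/-! ### A transducer that decodes blocks with the help of the oracle -/

section BlockDecoder

variable {Θ Λ : Type*}

/-- The states of the block decoder: the letters of the current oracle block and the bits of the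
current code word read so far, the symbols waiting to be printed, and the stage of the computation
(`0` for the initial symbols, `1` for the coded blocks, `2` for the final symbols). -/
abbrev DecoderState (Θ Λ : Type*) (N : ℕ) :=
  {a : List Θ // a.length ≤ N} × {b : List Bool // b.length ≤ N} × {s : List Λ // s.length ≤ N} × Fin 3

instance (N : ℕ) [Finite Θ] [Finite Λ] : Finite (DecoderState Θ Λ N) := by
  have h : ∀ (T : Type _) [Finite T], Finite {a : List T // a.length ≤ N} := fun T _ =>
    (List.finite_length_le T N).to_subtype
  have h1 := h Θ
  have h2 : Finite {a : List Bool // a.length ≤ N} := (List.finite_length_le Bool N).to_subtype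
  have h3 : Finite {a : List Λ // a.length ≤ N} := (List.finite_length_le Λ N).to_subtype
  infer_instance

/-- A state of the block decoder from lists that are cut off at the length `N`. -/
def decoderState (N : ℕ) (a : List Θ) (b : List Bool) (s : List Λ) (i : Fin 3) :
    DecoderState Θ Λ N :=
  (⟨a.take N, List.length_take_le _ _⟩, ⟨b.take N, List.length_take_le _ _⟩,
    ⟨s.take N, List.length_take_le _ _⟩, i)

/-- The transition function of the block decoder for the block length `k` and the decoding function
`dec`. In the stage `0` the decoder skips an oracle letter with every symbol it prints. At the end
of the input it prints the word `tail` and stops. -/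
def decoderStep (k N : ℕ) (dec : List Θ → List Bool → Option (List Λ)) (tail : List Λ)
    (q : DecoderState Θ Λ N) (β : Option Bool) (θ : Θ) :
    Option (DecoderState Θ Λ N × Option Λ × Bool × Bool) :=
  match q.2.2.1.1 with
  | x :: s => some (decoderState N q.1.1 q.2.1.1 s q.2.2.2, some x, false, q.2.2.2 = 0)
  | [] => if q.2.2.2 = 2 then none else
    match dec q.1.1 q.2.1.1 with
    | some v => some (decoderState N [] [] v 1, none, false, false)
    | none => match β with
      | none => some (decoderState N [] [] tail 2, none, false, false)
      | some c => if q.1.1.length < k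
        then some (decoderState N (q.1.1 ++ [θ]) q.2.1.1 [] q.2.2.2, none, false, true)
        else some (decoderState N q.1.1 (q.2.1.1 ++ [c]) [] q.2.2.2, none, true, false)

variable [Finite Θ] [Finite Λ] {k N : ℕ} {dec : List Θ → List Bool → Option (List Λ)}
  {head tail : List Λ}

/-- The machine that prints `head`, skipping as many oracle letters, then decodes its input
blockwise by means of the oracle, and finally prints `tail`. -/
noncomputable def blockDecoder (k N : ℕ) (dec : List Θ → List Bool → Option (List Λ))
    (head tail : List Λ) : OracleMachine Θ Λ :=
  ofTransducer (decoderStep k N dec tail) (decoderState N [] [] head 0)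

/-- The configurations of the block decoder. -/
noncomputable def decoderCfg (k N : ℕ) (dec : List Θ → List Bool → Option (List Λ))
    (head tail : List Λ) (a : List Θ) (b : List Bool) (s : List Λ) (i : Fin 3) (u : List Bool)
    (α : ℕ → Θ) (v : List Λ) : (blockDecoder k N dec head tail).Cfg :=
  transducerCfg (decoderStep k N dec tail) (decoderState N [] [] head 0) (decoderState N a b s i) u α v

/-- Length bounds are needed for the current lists only: the lists of the next configuration are cut
off in the same way on both sides. -/
lemma next_decoderCfg {a : List Θ} {b : List Bool} {s : List Λ} (ha : a.length ≤ N)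
    (hb : b.length ≤ N) (hs : s.length ≤ N) (i : Fin 3) (u : List Bool) (α : ℕ → Θ) (v : List Λ) :
    (blockDecoder k N dec head tail).next (decoderCfg k N dec head tail a b s i u α v) =
      match s with
      | x :: s => some (decoderCfg k N dec head tail a b s i u
          (if i = 0 then fun n => α (n + 1) else α) (v ++ [x]))
      | [] => if i = 2 then none else
        match dec a b with
        | some w => some (decoderCfg k N dec head tail [] [] w 1 u α v)
        | none => match u with
          | [] => some (decoderCfg k N dec head tail [] [] tail 2 u α v)
          | c :: u => if a.length < k
            then some (decoderCfg k N dec head tail (a ++ [α 0]) b [] i (c :: u)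
              (fun n => α (n + 1)) v)
            else some (decoderCfg k N dec head tail a (b ++ [c]) [] i u α v) := by
  refine (next_transducerCfg _ _ _ _).trans ?_
  simp only [decoderStep, decoderState, List.take_of_length_le ha, List.take_of_length_le hb,
    List.take_of_length_le hs]
  cases s with
  | cons x s =>
    simp only [decoderCfg, decoderState, List.take_of_length_le ha, List.take_of_length_le hb]
    simp
    rfl
  | nil =>
    by_cases hi : i = 2
    · simp only [hi, if_true]; rfl
    · simp only [hi, if_false]
      cases dec a b with
      | some w => simp [decoderCfg, decoderState]; rfl
      | none =>
        cases u with
        | nil => simp [decoderCfg, decoderState]; rfl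
        | cons c u =>
          simp only [decoderCfg, decoderState, List.take_of_length_le ha, List.take_of_length_le hb]
          by_cases hk : a.length < k
          · simp [hk]; rfl
          · simp [hk]; rfl

local notation "Reach" => StateTransition.Reaches (OracleMachine.next (blockDecoder k N dec head tail))
local notation "cfg" => decoderCfg k N dec head tail

lemma decoder_print_body {s : List Λ} {i : Fin 3} (hs : s.length ≤ N) (hi : i ≠ 0)
    (u : List Bool) (α : ℕ → Θ) (v : List Λ) :
    Reach (cfg [] [] s i u α v) (cfg [] [] [] i u α (v ++ s)) := by
  induction s generalizing v with
  | nil => rw [List.append_nil]; exact Relation.ReflTransGen.refl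
  | cons x s ih =>
    have h := next_decoderCfg (dec := dec) (head := head) (tail := tail) (k := k) (N := N)
      (a := []) (b := []) (by simp) (by simp) hs i u α v
    simp only [hi, if_false] at h
    have h2 := ih ((Nat.le_succ _).trans hs) (v ++ [x])
    rw [List.append_assoc] at h2
    exact Relation.ReflTransGen.head h h2

lemma decoder_print_head {s : List Λ} (hs : s.length ≤ N) (u : List Bool) (α : ℕ → Θ) (v : List Λ) :
    Reach (cfg [] [] s 0 u α v) (cfg [] [] [] 0 u (fun n => α (n + s.length)) (v ++ s)) := by
  induction s generalizing v α with
  | nil => rw [List.append_nil]; exact Relation.ReflTransGen.refl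
  | cons x s ih =>
    have h := next_decoderCfg (dec := dec) (head := head) (tail := tail) (k := k) (N := N)
      (a := []) (b := []) (by simp) (by simp) hs 0 u α v
    simp only [if_true] at h
    have h2 := ih ((Nat.le_succ _).trans hs) (fun n => α (n + 1)) (v ++ [x])
    rw [List.append_assoc] at h2
    exact Relation.ReflTransGen.head h h2

/-- Oracle letters are collected only while input remains, since at the end of the input the decoder
turns to the final symbols; hence the condition on `u`. -/
lemma decoder_collect (hkN : k ≤ N) (hdec : ∀ a b, a.length < k → dec a b = none) {i : Fin 3}
    (hi : i ≠ 2) {u : List Bool} (hu : u ≠ []) (α : ℕ → Θ) (v : List Λ) {j : ℕ} (hj : j ≤ k) :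
    Reach (cfg [] [] [] i u α v)
      (cfg ((List.range j).map α) [] [] i u (fun n => α (n + j)) v) := by
  induction j with
  | zero => exact Relation.ReflTransGen.refl
  | succ j ih =>
    have hl : ((List.range j).map α).length < k := by simpa using hj
    have h := next_decoderCfg (dec := dec) (head := head) (tail := tail) (k := k) (N := N)
      (a := (List.range j).map α) (b := []) (s := []) (hl.le.trans hkN) (by simp) (by simp) i u
      (fun n => α (n + j)) v
    obtain ⟨c, u, rfl⟩ := List.exists_cons_of_ne_nil hu
    simp only [hi, if_false, hdec _ _ hl, hl, if_true, Nat.zero_add] at h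
    rw [List.range_succ, List.map_append]
    have e : (fun n => α (n + (j + 1))) = fun n => α (n + 1 + j) := by
      funext n; congr 1; omega
    rw [e]
    exact (ih (by omega)).tail h

lemma decoder_read (hkN : k ≤ N) {a : List Θ} (ha : a.length = k) {i : Fin 3} (hi : i ≠ 2)
    {e : List Bool} (heN : e.length ≤ N)
    (hpre : ∀ b, b <+: e → b ≠ e → dec a b = none) (b b' : List Bool) (hbb' : b ++ b' = e)
    (u : List Bool) (α : ℕ → Θ) (v : List Λ) :
    Reach (cfg a b [] i (b' ++ u) α v) (cfg a e [] i u α v) := by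
  induction b' generalizing b with
  | nil =>
    rw [List.append_nil] at hbb'
    subst hbb'
    exact Relation.ReflTransGen.refl
  | cons c b' ih =>
    have hne : b ≠ e := by
      rintro rfl; simp at hbb'
    have hd := hpre b ⟨_, hbb'⟩ hne
    have hbN : b.length ≤ N := by
      rw [← hbb', List.length_append] at heN; omega
    have h := next_decoderCfg (dec := dec) (head := head) (tail := tail) (k := k) (N := N)
      (a := a) (b := b) (s := []) (ha.le.trans hkN) hbN (by simp) i (c :: (b' ++ u)) α v
    have hl : ¬ a.length < k := by omega
    simp only [hi, if_false, hd, hl] at h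
    exact Relation.ReflTransGen.head h (ih (b ++ [c]) (by simpa using hbb'))

/-- The decoder decodes a block. -/
lemma decoder_block (hkN : k ≤ N) (hdec : ∀ a b, a.length < k → dec a b = none) {i : Fin 3}
    (hi : i ≠ 2) {α : ℕ → Θ} {e : List Bool} (he : e ≠ []) (heN : e.length ≤ N)
    (hpre : ∀ b, b <+: e → b ≠ e → dec ((List.range k).map α) b = none) {w : List Λ}
    (hw : dec ((List.range k).map α) e = some w) (hwN : w.length ≤ N) (u : List Bool) (v : List Λ) :
    Reach (cfg [] [] [] i (e ++ u) α v) (cfg [] [] [] 1 u (fun n => α (n + k)) (v ++ w)) := by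
  have h1 := decoder_collect (head := head) (tail := tail) hkN hdec hi (u := e ++ u) (by simp [he])
    α v le_rfl
  have h2 := decoder_read (head := head) (tail := tail) hkN (a := (List.range k).map α) (by simp) hi
    heN hpre [] e rfl u (fun n => α (n + k)) v
  have h3 := next_decoderCfg (dec := dec) (head := head) (tail := tail) (k := k) (N := N)
    (a := (List.range k).map α) (b := e) (s := []) (by simpa using hkN) heN (by simp) i u
    (fun n => α (n + k)) v
  simp only [hi, if_false, hw] at h3
  exact ((h1.trans h2).tail h3).trans (decoder_print_body hwN (by decide) u _ v)

/-- The output of the block decoder on a sequence of code words. -/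
theorem mem_eval_blockDecoder (hkN : k ≤ N) (hk : 0 < k)
    (hdec : ∀ a b, a.length < k → dec a b = none)
    {α : ℕ → Θ} (hhead : head.length ≤ N) (htail : tail.length ≤ N) {J : ℕ} {e : ℕ → List Bool}
    {w : ℕ → List Λ} (he : ∀ j < J, e j ≠ []) (heN : ∀ j < J, (e j).length ≤ N)
    (hpre : ∀ j < J, ∀ b, b <+: e j → b ≠ e j →
      dec ((List.range k).map fun n => α (n + (head.length + j * k))) b = none)
    (hw : ∀ j < J, dec ((List.range k).map fun n => α (n + (head.length + j * k))) (e j) = some (w j))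
    (hwN : ∀ j < J, (w j).length ≤ N) :
    head ++ (List.range J).flatMap w ++ tail ∈
      (blockDecoder k N dec head tail).eval α ((List.range J).flatMap e) := by
  -- The stage is 0 before the first block and 1 after it. The remaining input `u` is arbitrary, so
  -- that the induction can split off the next code word from it.
  have hblocks : ∀ j ≤ J, ∃ i : Fin 3, i ≠ 2 ∧ ∀ u,
      Reach (cfg [] [] head 0 ((List.range j).flatMap e ++ u) α [])
        (cfg [] [] [] i u (fun n => α (n + (head.length + j * k)))
          (head ++ (List.range j).flatMap w)) := by
    intro j
    induction j with
    | zero =>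
      intro _
      refine ⟨0, by decide, fun u => ?_⟩
      have := decoder_print_head (dec := dec) (head := head) (tail := tail) (k := k) hhead u α []
      simpa using this
    | succ j ih =>
      intro hj
      obtain ⟨i, hi, hr⟩ := ih (by omega)
      refine ⟨1, by decide, fun u => ?_⟩
      have h1 := hr (e j ++ u)
      have h2 := decoder_block (head := head) (tail := tail) hkN hdec hi (he j hj) (heN j hj)
        (hpre j hj) (hw j hj) (hwN j hj) u (head ++ (List.range j).flatMap w)
      have e1 : (List.range (j + 1)).flatMap e ++ u = (List.range j).flatMap e ++ (e j ++ u) := by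
        simp [List.range_succ]
      have e2 : head ++ (List.range (j + 1)).flatMap w =
          head ++ (List.range j).flatMap w ++ w j := by
        simp [List.range_succ]
      have e3 : (fun n => α (n + (head.length + (j + 1) * k))) =
          fun n => α (n + k + (head.length + j * k)) := by
        funext n; congr 1; ring
      rw [e1, e2, e3]
      exact h1.trans h2
  obtain ⟨i, hi, hr⟩ := hblocks J le_rfl
  have h1 := hr []
  rw [List.append_nil] at h1
  have h2 := next_decoderCfg (dec := dec) (head := head) (tail := tail) (k := k) (N := N)
    (a := []) (b := []) (s := []) (by simp) (by simp) (by simp) i []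
    (fun n => α (n + (head.length + J * k))) (head ++ (List.range J).flatMap w)
  simp only [hi, if_false, hdec [] [] hk] at h2
  have h3 := (h1.tail h2).trans (decoder_print_body htail (by decide) _ _ _)
  refine (mem_eval_iff _).2 ⟨_, h3, ?_, rfl⟩
  have h4 := next_decoderCfg (dec := dec) (head := head) (tail := tail) (k := k) (N := N)
    (a := []) (b := []) (s := []) (by simp) (by simp) (by simp) 2 []
    (fun n => α (n + (head.length + J * k))) (head ++ (List.range J).flatMap w ++ tail)
  simpa using h4

end BlockDecoder

/-- The invariance theorem: selecting `M` costs a fixed prefix, which depends neither on the oracle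
nor on the input. -/
lemma IsUniversal.exists_condComplexity_le {Θ Λ : Type*} {U : OracleMachine Θ Λ}
    (hU : U.IsUniversal) (M : OracleMachine Θ Λ) :
    ∃ K : ℕ, ∀ (α : ℕ → Θ) (u : List Bool) (v : List Λ), v ∈ M.eval α u →
      U.condComplexity v α ≤ (K + u.length : ℕ) := by
  obtain ⟨w, hw⟩ := hU M
  refine ⟨w.length, fun α u v hv => (condComplexity_le_iff U).2 ⟨w ++ u, by simp, ?_⟩⟩
  rw [hw]; exact hv

end OracleMachine

/-! ### Prefix-free codes with nearly optimal lengths -/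

section Codes

open Real

/-- Take the rounded-up information, capped at `N`, and `N` itself for outcomes of weight zero. An
outcome of length `i < N` has weight at least `P / 2 ^ i`, so there are at most `2 ^ i` of them; for
`i ≥ N` the cardinality of `V` suffices. -/
lemma exists_codeLength {V : Type*} [Fintype V] {p : V → ℝ} (hp : ∀ v, 0 ≤ p v) {P : ℝ}
    (hP : ∑ v, p v ≤ P) {N : ℕ} (hN : Fintype.card V ≤ 2 ^ N) :
    ∃ l : V → ℕ, (∀ v, l v ≤ N) ∧ (∀ i, Nat.card {v // l v = i} ≤ 2 ^ i) ∧
      ∀ v, 0 < p v → (l v : ℝ) ≤ logb 2 (P / p v) + 1 := by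
  classical
  have hle : ∀ v, p v ≤ P := fun v =>
    (Finset.single_le_sum (f := p) (fun v _ => hp v) (Finset.mem_univ v)).trans hP
  refine ⟨fun v => if p v = 0 then N else min N ⌈logb 2 (P / p v)⌉₊, fun v => ?_, fun i => ?_,
    fun v hv => ?_⟩
  · dsimp only
    split_ifs
    exacts [le_rfl, min_le_left _ _]
  · by_cases hi : N ≤ i
    · rw [Nat.card_eq_fintype_card]
      exact (Fintype.card_subtype_le _).trans (hN.trans (Nat.pow_le_pow_right (by norm_num) hi))
    · set s : Finset V := {v | (if p v = 0 then N else min N ⌈logb 2 (P / p v)⌉₊) = i} with hs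
      have hcard : Nat.card {v // (if p v = 0 then N else min N ⌈logb 2 (P / p v)⌉₊) = i} = s.card := by
        rw [Nat.card_eq_fintype_card, Fintype.card_subtype]
      rw [hcard]
      have hmem : ∀ v ∈ s, 0 < p v ∧ P * (2 ^ i)⁻¹ ≤ p v := by
        intro v hv
        simp only [hs, Finset.mem_filter, Finset.mem_univ, true_and] at hv
        split_ifs at hv with h0
        · omega
        have h1 : 0 < p v := lt_of_le_of_ne (hp v) (Ne.symm h0)
        refine ⟨h1, ?_⟩
        have h2 : ⌈logb 2 (P / p v)⌉₊ = i := by omega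
        have h3 := Nat.le_ceil (logb 2 (P / p v))
        rw [h2, logb_le_iff_le_rpow (by norm_num) (div_pos (h1.trans_le (hle v)) h1),
          div_le_iff₀ h1, rpow_natCast] at h3
        rw [← div_eq_mul_inv, div_le_iff₀ (by positivity), mul_comm]
        exact h3
      rcases s.eq_empty_or_nonempty with he | ⟨v, hv⟩
      · simp [he]
      have hPpos : 0 < P := (hmem v hv).1.trans_le (hle v)
      have h1 : s.card • (P * (2 ^ i)⁻¹) ≤ P :=
        (Finset.card_nsmul_le_sum s p _ fun v hv => (hmem v hv).2).trans
          ((Finset.sum_le_univ_sum_of_nonneg hp).trans hP)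
      rw [nsmul_eq_mul, mul_left_comm, mul_le_iff_le_one_right hPpos, ← div_eq_mul_inv,
        div_le_one (by positivity)] at h1
      exact_mod_cast h1
  · have h1 : 1 ≤ P / p v := by rw [le_div_iff₀ hv, one_mul]; exact hle v
    have h2 := (Nat.ceil_lt_add_one (logb_nonneg (b := 2) (by norm_num) h1)).le
    simp only [hv.ne', if_false]
    refine le_trans ?_ h2
    exact_mod_cast min_le_right _ _

/-- A prefix-free binary code whose code word lengths exceed the information by at most `D + 1`. A
code word consists of `D` bits that specify the length of the remaining part. -/
lemma exists_prefixCode {V : Type*} [Fintype V] {p : V → ℝ} (hp : ∀ v, 0 ≤ p v) {P : ℝ}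
    (hP : ∑ v, p v ≤ P) {N D : ℕ} (hN : Fintype.card V ≤ 2 ^ N) (hD : 0 < D) (hND : N + 1 ≤ 2 ^ D) :
    ∃ e : V → List Bool, (∀ v v', e v <+: e v' → v = v') ∧ (∀ v, e v ≠ []) ∧
      (∀ v, (e v).length ≤ D + N) ∧ ∀ v, 0 < p v → ((e v).length : ℝ) ≤ D + 1 + logb 2 (P / p v) := by
  obtain ⟨l, hlN, hl, hlp⟩ := exists_codeLength hp hP hN
  obtain ⟨f⟩ : Nonempty (Fin (N + 1) ↪ (Fin D → Bool)) :=
    Function.Embedding.nonempty_of_card_le (by simpa using hND)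
  have hg : ∀ i, Nonempty ({v // l v = i} ↪ (Fin i → Bool)) := fun i => by
    classical
    exact Function.Embedding.nonempty_of_card_le (by simpa [Nat.card_eq_fintype_card] using hl i)
  set g := fun i => (hg i).some
  set e : V → List Bool := fun v => List.ofFn (f ⟨l v, Nat.lt_succ_iff.2 (hlN v)⟩) ++
    List.ofFn (g (l v) ⟨v, rfl⟩) with he
  have hlen : ∀ v, (e v).length = D + l v := fun v => by simp [he]
  refine ⟨e, fun v v' hvv' => ?_, fun v h => ?_, fun v => ?_, fun v hv => ?_⟩
  · obtain ⟨t, ht⟩ := hvv'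
    simp only [he, List.append_assoc] at ht
    -- The headers have the common length `D`, so they agree; then so do the lengths of the
    -- remaining parts, and one being a prefix of the other means equality.
    obtain ⟨h1, h2⟩ := List.append_inj ht (by simp)
    have h3 : l v = l v' := by simpa using f.injective (List.ofFn_injective h1)
    have h4 : ∀ i (hv : l v = i), List.ofFn (g (l v) ⟨v, rfl⟩) = List.ofFn (g i ⟨v, hv⟩) := by
      rintro i rfl; rfl
    rw [h4 _ h3] at h2
    have h5 := (List.append_inj (h2.trans (List.append_nil _).symm) (by simp)).1
    simpa using (g (l v')).injective (List.ofFn_injective h5)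
  · have := hlen v
    rw [h] at this
    simp at this; omega
  · rw [hlen]; have := hlN v; omega
  · rw [hlen]; push_cast; linarith [hlp v hv]

end Codes

/-! ### Complexity bounded by code lengths averaged over all offsets -/

namespace OracleMachine

variable {Θ Λ : Type*}

/-- The function that decodes the words `enc a v` given `a`. -/
noncomputable def blockDecoding {k : ℕ} (enc : (Fin k → Θ) → (Fin k → Λ) → List Bool) (a : List Θ)
    (b : List Bool) : Option (List Λ) := by
  classical
  exact if h : ∃ (a' : Fin k → Θ) (v : Fin k → Λ), List.ofFn a' = a ∧ enc a' v = b
    then some (List.ofFn h.choose_spec.choose) else none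

lemma blockDecoding_enc {k : ℕ} {enc : (Fin k → Θ) → (Fin k → Λ) → List Bool}
    (henc : ∀ a v v', enc a v <+: enc a v' → v = v') (a : Fin k → Θ) (v : Fin k → Λ) :
    blockDecoding enc (List.ofFn a) (enc a v) = some (List.ofFn v) := by
  have h : ∃ (a' : Fin k → Θ) (v' : Fin k → Λ), List.ofFn a' = List.ofFn a ∧ enc a' v' = enc a v :=
    ⟨a, v, rfl, rfl⟩
  rw [blockDecoding, dif_pos h]
  have h1 := h.choose_spec.choose_spec
  have key : ∀ a' v', a' = a → enc a' v' = enc a v → v' = v := by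
    rintro _ v' rfl h
    exact henc _ _ _ (by rw [h])
  rw [key _ _ (List.ofFn_injective h1.1) h1.2]

lemma blockDecoding_eq_none_of_length_lt {k : ℕ} {enc : (Fin k → Θ) → (Fin k → Λ) → List Bool}
    {a : List Θ} (ha : a.length < k) (b : List Bool) : blockDecoding enc a b = none := by
  rw [blockDecoding, dif_neg]
  rintro ⟨a', v, rfl, -⟩
  simp at ha

lemma blockDecoding_eq_none_of_prefix {k : ℕ} {enc : (Fin k → Θ) → (Fin k → Λ) → List Bool}
    (henc : ∀ a v v', enc a v <+: enc a v' → v = v') {a : Fin k → Θ} {v : Fin k → Λ}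
    {b : List Bool} (hb : b <+: enc a v) (hne : b ≠ enc a v) :
    blockDecoding enc (List.ofFn a) b = none := by
  rw [blockDecoding, dif_neg]
  rintro ⟨a', v', h1, rfl⟩
  obtain rfl := List.ofFn_injective h1
  exact hne (by rw [henc _ _ _ hb])

lemma map_range_eq_ofFn {T : Type*} (k : ℕ) (f : ℕ → T) :
    (List.range k).map f = List.ofFn fun i : Fin k => f i :=
  List.ext_getElem (by simp) fun i _ _ => by simp

lemma flatMap_map_range {T : Type*} (f : ℕ → T) (r k J : ℕ) :
    (List.range r).map f ++ (List.range J).flatMap (fun j => (List.range k).map fun n =>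
      f (n + (r + j * k))) = (List.range (r + J * k)).map f := by
  induction J with
  | zero => simp
  | succ J ih =>
    rw [List.range_succ, List.flatMap_append, ← List.append_assoc, ih]
    have : r + (J + 1) * k = r + J * k + k := by ring
    rw [this, List.range_add (n := r + J * k), List.map_append, List.map_map]
    congr 1
    simp only [List.flatMap_singleton]
    exact List.map_congr_left fun i _ => by rw [Function.comp_apply, add_comm]

lemma length_flatMap_range (e : ℕ → List Bool) (J : ℕ) :
    ((List.range J).flatMap e).length = ∑ j ∈ Finset.range J, (e j).length := by
  induction J with
  | zero => simp
  | succ J ih => rw [Finset.sum_range_succ, ← ih, List.range_succ]; simp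

lemma sum_range_mul (F : ℕ → ℕ) (k J : ℕ) :
    ∑ r ∈ Finset.range k, ∑ j ∈ Finset.range J, F (r + j * k) = ∑ i ∈ Finset.range (J * k), F i := by
  rw [Finset.sum_comm]
  induction J with
  | zero => simp
  | succ J ih =>
    rw [Finset.sum_range_succ, ih, Nat.succ_mul, Finset.sum_range_add]
    simp [add_comm]

/-- The upper bound of the complexity of the initial words of a sequence by the lengths of code
words for overlapping blocks of length `k`. -/
theorem IsUniversal.exists_condComplexity_le_sum [Finite Θ] [Finite Λ] {U : OracleMachine Θ Λ}
    (hU : U.IsUniversal) {k : ℕ} (hk : 0 < k) {enc : (Fin k → Θ) → (Fin k → Λ) → List Bool}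
    (henc : ∀ a v v', enc a v <+: enc a v' → v = v') (hne : ∀ a v, enc a v ≠ []) :
    ∃ K : ℕ, ∀ (α : ℕ → Θ) (ω : ℕ → Λ) (n : ℕ), ∃ c : ℕ,
      U.condComplexity ((List.range n).map ω) α ≤ c ∧
        k * c ≤ K + ∑ i ∈ Finset.range n, (enc (fun j => α (j + i)) fun j => ω (j + i)).length := by
  obtain ⟨L, hL⟩ : ∃ L, ∀ a v, (enc a v).length ≤ L := by
    obtain ⟨L, hL⟩ := Finite.bddAbove_range
      fun p : (Fin k → Θ) × (Fin k → Λ) => (enc p.1 p.2).length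
    exact ⟨L, fun a v => hL ⟨(a, v), rfl⟩⟩
  -- Large enough for the head (shorter than `k`), the tail (at most `2 * k`) and every code word.
  set N := 2 * k + L
  -- The decoder has the head and the tail built in. As these range over finitely many words, the
  -- simulation costs have a common bound `K₀`.
  choose K hK using fun p : {s : List Λ // s.length ≤ N} × {s : List Λ // s.length ≤ N} =>
    hU.exists_condComplexity_le (blockDecoder k N (blockDecoding enc) p.1.1 p.2.1)
  have : Finite {s : List Λ // s.length ≤ N} := (List.finite_length_le Λ N).to_subtype
  obtain ⟨K₀, hK₀⟩ := Finite.bddAbove_range K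
  refine ⟨k * K₀, fun α ω n => ?_⟩
  set F : ℕ → ℕ := fun i => (enc (fun j => α (j + i)) fun j => ω (j + i)).length
  have key : ∀ r J, r < k → r + J * k ≤ n → n ≤ r + J * k + 2 * k →
      U.condComplexity ((List.range n).map ω) α ≤
        (K₀ + ∑ j ∈ Finset.range J, F (r + j * k) : ℕ) := by
    intro r J hr hle hge
    set head := (List.range r).map ω with hhead
    set tail := (List.range (n - (r + J * k))).map fun i => ω (r + J * k + i) with htail
    have hhl : head.length = r := by simp [hhead]
    have h1 : head.length ≤ N := by omega
    have h2 : tail.length ≤ N := by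
      have : tail.length = n - (r + J * k) := by simp [htail]
      omega
    have hkN : k ≤ N := by omega
    have hmem := mem_eval_blockDecoder (dec := blockDecoding enc) (α := α) hkN hk
      (fun a b ha => blockDecoding_eq_none_of_length_lt ha b) h1 h2 (J := J)
      (e := fun j => enc (fun i => α (i + (r + j * k))) fun i => ω (i + (r + j * k)))
      (w := fun j => (List.range k).map fun i => ω (i + (r + j * k)))
      (fun j _ => hne _ _) (fun j _ => (hL _ _).trans (by omega))
      (fun j _ b hb hb' => by
        rw [hhl, map_range_eq_ofFn]
        exact blockDecoding_eq_none_of_prefix henc hb hb')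
      (fun j _ => by
        rw [hhl, map_range_eq_ofFn, map_range_eq_ofFn]
        exact blockDecoding_enc henc _ _)
      (fun j _ => by simpa using hkN)
    have hout : head ++ (List.range J).flatMap (fun j => (List.range k).map fun i =>
        ω (i + (r + j * k))) ++ tail = (List.range n).map ω := by
      rw [hhead, flatMap_map_range, htail]
      conv_rhs => rw [← Nat.add_sub_of_le hle, List.range_add, List.map_append, List.map_map]
      rfl
    rw [hout] at hmem
    refine (hK (⟨head, h1⟩, ⟨tail, h2⟩) α _ _ hmem).trans ?_
    rw [length_flatMap_range]
    have := hK₀ ⟨(⟨head, h1⟩, ⟨tail, h2⟩), rfl⟩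
    exact_mod_cast Nat.add_le_add_right this _
  by_cases hnk : n < k
  · refine ⟨K₀, by simpa using key 0 0 hk (by simp) (by omega), Nat.le_add_right _ _⟩
  push Not at hnk
  have hdiv := Nat.div_add_mod n k
  have hmod := Nat.mod_lt n hk
  have hq : 1 ≤ n / k := (Nat.one_le_div_iff hk).2 hnk
  -- One block fewer than fits, which leaves room for every offset `r < k`.
  obtain ⟨J, hJ⟩ : ∃ J, n / k = J + 1 := ⟨n / k - 1, by omega⟩
  rw [hJ, mul_add, mul_one, mul_comm] at hdiv
  have hc : ∀ r < k, U.condComplexity ((List.range n).map ω) α ≤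
      (K₀ + ∑ j ∈ Finset.range J, F (r + j * k) : ℕ) := fun r hr =>
    key r J hr (by omega) (by omega)
  obtain ⟨c, hc'⟩ := ENat.ne_top_iff_exists.1 (ne_top_of_le_ne_top (ENat.natCast_ne_top _) (hc 0 hk))
  refine ⟨c, hc'.symm.le, ?_⟩
  rw [← hc'] at hc
  -- The bound holds for each of the `k` offsets. In their sum every position below `J * k` occurs
  -- exactly once as the start of a block.
  calc k * c = ∑ r ∈ Finset.range k, c := by simp
    _ ≤ ∑ r ∈ Finset.range k, (K₀ + ∑ j ∈ Finset.range J, F (r + j * k)) :=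
        Finset.sum_le_sum fun r hr => by exact_mod_cast hc r (Finset.mem_range.1 hr)
    _ = k * K₀ + ∑ i ∈ Finset.range (J * k), F i := by
        rw [Finset.sum_add_distrib, sum_range_mul]; simp
    _ ≤ k * K₀ + ∑ i ∈ Finset.range n, F i :=
        Nat.add_le_add_left (Finset.sum_le_sum_of_subset
          (Finset.range_mono (by omega))) _

end OracleMachine

/-! ### Letterwise images of processes -/

section LetterMaps

variable {A B : Type*} [MeasurableSpace A] [DiscreteMeasurableSpace A]
  [MeasurableSpace B] [DiscreteMeasurableSpace B]

/-- The map of sequences that applies `f` to every letter. -/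
def mapSeq (f : A → B) (x : ℕ → A) : ℕ → B := fun n => f (x n)

lemma measurable_mapSeq (f : A → B) : Measurable (mapSeq f) :=
  measurable_pi_lambda _ fun n => (Measurable.of_discrete (f := f)).comp (measurable_pi_apply n)

lemma iterate_seqShift (i : ℕ) (x : ℕ → A) : seqShift^[i] x = fun n => x (n + i) := by
  induction i generalizing x with
  | zero => rfl
  | succ i ih =>
    rw [Function.iterate_succ_apply, ih]
    funext n
    simp only [seqShift]
    congr 1

variable {m : Measure (ℕ → A)}

lemma ergodic_map_mapSeq (hm : Ergodic seqShift m) (f : A → B) :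
    Ergodic seqShift (m.map (mapSeq f)) :=
  (Measurable.measurePreserving (measurable_mapSeq f) m).ergodic_of_ergodic_semiconj hm
    measurable_seqShift fun _ => rfl

instance [IsProbabilityMeasure m] (f : A → B) : IsProbabilityMeasure (m.map (mapSeq f)) :=
  Measure.isProbabilityMeasure_map (measurable_mapSeq f).aemeasurable

lemma wordProb_map (f : A → B) {n : ℕ} (w : Fin n → B) :
    wordProb (m.map (mapSeq f)) w = m.real {x | f ∘ initialWord n x = w} := by
  rw [wordProb, map_measureReal_apply (measurable_mapSeq f)
    (measurable_initialWord n (measurableSet_singleton w))]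
  rfl

lemma wordProb_map_equiv (e : A ≃ B) {n : ℕ} (w : Fin n → A) :
    wordProb (m.map (mapSeq e)) (e ∘ w) = wordProb m w := by
  rw [wordProb_map, wordProb]
  congr 1
  ext x
  exact (e.injective.comp_left).eq_iff

lemma blockEntropy_map_equiv [Fintype A] [Fintype B] (e : A ≃ B) (n : ℕ) :
    blockEntropy (m.map (mapSeq e)) n = blockEntropy m n := by
  rw [blockEntropy, blockEntropy, ← (Equiv.arrowCongr (Equiv.refl (Fin n)) e).sum_comp]
  refine Finset.sum_congr rfl fun w _ => ?_
  rw [← wordProb_map_equiv e w]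
  rfl

lemma entropyRate_map_equiv [Fintype A] [Fintype B] [IsProbabilityMeasure m]
    (hm : MeasurePreserving seqShift m m) (e : A ≃ B) :
    entropyRate (m.map (mapSeq e)) = entropyRate m := by
  have hm' : MeasurePreserving seqShift (m.map (mapSeq e)) (m.map (mapSeq e)) := by
    refine ⟨measurable_seqShift, ?_⟩
    rw [Measure.map_map measurable_seqShift (measurable_mapSeq e)]
    conv_rhs => rw [← hm.map_eq, Measure.map_map (measurable_mapSeq e) measurable_seqShift]
    rfl
  refine tendsto_nhds_unique (tendsto_blockEntropy_div hm') ?_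
  simp_rw [blockEntropy_map_equiv e]
  exact tendsto_blockEntropy_div hm

lemma entropyRate_nonneg [Fintype A] [IsProbabilityMeasure m] : 0 ≤ entropyRate m :=
  integral_nonneg fun _ => Finset.sum_nonneg fun a _ =>
    Real.negMulLog_nonneg ENNReal.toReal_nonneg (toReal_letterDensity_le_one a _)

end LetterMaps

/-! ### Upper bound for the conditional complexity -/

section Pairs

open Real Topology

variable {A B : Type*} [Fintype A] [MeasurableSpace A] [DiscreteMeasurableSpace A]
  [Fintype B] [MeasurableSpace B] [DiscreteMeasurableSpace B] {m : Measure (ℕ → A × B)} [IsProbabilityMeasure m]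

/-- The word of pairs with given components. -/
def pairWord {n : ℕ} (a : Fin n → A) (v : Fin n → B) : Fin n → A × B := fun i => (a i, v i)

/-- The distribution of the sequence of the first components. -/
noncomputable abbrev fstMarginal (m : Measure (ℕ → A × B)) : Measure (ℕ → A) :=
  m.map (mapSeq Prod.fst)

lemma sum_pairWord {n : ℕ} (φ : (Fin n → A × B) → ℝ) :
    ∑ w, φ w = ∑ a, ∑ v, φ (pairWord a v) := by
  rw [← (Equiv.arrowProdEquivProdArrow (Fin n) (fun _ => A) (fun _ => B)).symm.sum_comp,
    Fintype.sum_prod_type]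
  rfl

lemma sum_wordProb_pairWord {n : ℕ} (a : Fin n → A) :
    ∑ v, wordProb m (pairWord a v) = wordProb (fstMarginal m) a := by
  have h : {x : ℕ → A × B | Prod.fst ∘ initialWord n x = a} =
      ⋃ v : Fin n → B, initialWord n ⁻¹' {pairWord a v} := by
    ext x
    simp only [Set.mem_ofPred_eq, Set.mem_iUnion, Set.mem_preimage, Set.mem_singleton_iff]
    constructor
    · rintro rfl
      exact ⟨Prod.snd ∘ initialWord n x, rfl⟩
    · rintro ⟨v, hv⟩
      rw [hv]; rfl
  rw [wordProb_map, h, measureReal_iUnion_fintype]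
  · rfl
  · intro v v' hvv'
    refine Disjoint.preimage _ (Set.disjoint_singleton.2 fun h => hvv' ?_)
    funext i
    exact congrArg Prod.snd (congrFun h i)
  · exact fun v => measurable_initialWord n (measurableSet_singleton _)

/-- The mean code word length is bounded by the conditional block entropy. -/
lemma integral_length_le {k : ℕ} {D : ℕ}
    {enc : (Fin k → A) → (Fin k → B) → List Bool}
    (h : ∀ a v, 0 < wordProb m (pairWord a v) → ((enc a v).length : ℝ) ≤
      D + 1 + logb 2 (wordProb (fstMarginal m) a / wordProb m (pairWord a v))) :
    ∫ x, ((enc (Prod.fst ∘ initialWord k x) (Prod.snd ∘ initialWord k x)).length : ℝ) ∂m ≤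
      D + 1 + (blockEntropy m k - blockEntropy (fstMarginal m) k) / log 2 := by
  rw [integral_comp_initialWord (m := m) fun w => ((enc (Prod.fst ∘ w) (Prod.snd ∘ w)).length : ℝ),
    sum_pairWord]
  have hterm : ∀ a v, wordProb m (pairWord a v) * ((enc a v).length : ℝ) ≤
      wordProb m (pairWord a v) * (D + 1) + (negMulLog (wordProb m (pairWord a v)) +
        wordProb m (pairWord a v) * log (wordProb (fstMarginal m) a)) / log 2 := by
    intro a v
    rcases (wordProb_nonneg (m := m) (pairWord a v)).eq_or_lt with h0 | h0
    · simp [← h0]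
    have h1 : 0 < wordProb (fstMarginal m) a := by
      rw [← sum_wordProb_pairWord]
      exact h0.trans_le (Finset.single_le_sum (f := fun v => wordProb m (pairWord a v))
        (fun _ _ => wordProb_nonneg _) (Finset.mem_univ v))
    refine (mul_le_mul_of_nonneg_left (h a v h0) h0.le).trans_eq ?_
    rw [logb, log_div h1.ne' h0.ne', negMulLog]
    ring
  refine (Finset.sum_le_sum fun a _ => Finset.sum_le_sum fun v _ => hterm a v).trans_eq ?_
  have h1 : ∑ a, ∑ v, wordProb m (pairWord (n := k) a v) = 1 := by
    rw [← sum_pairWord, sum_wordProb]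
  have h2 : ∑ a, ∑ v, negMulLog (wordProb m (pairWord (n := k) a v)) = blockEntropy m k := by
    rw [← sum_pairWord fun w => negMulLog (wordProb m w), blockEntropy]
  have h3 : ∑ a : Fin k → A, ∑ v, wordProb m (pairWord a v) * log (wordProb (fstMarginal m) a) =
      -blockEntropy (fstMarginal m) k := by
    simp_rw [← Finset.sum_mul, sum_wordProb_pairWord, blockEntropy, negMulLog]
    simp
  simp_rw [Finset.sum_add_distrib, ← Finset.sum_div, Finset.sum_add_distrib, ← Finset.sum_mul]
  rw [h1, h2]
  simp_rw [← Finset.sum_mul] at h3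
  rw [h3]
  ring

/-- The header that announces the length of a code word is logarithmic in the block length, hence
negligible per letter. -/
lemma tendsto_log_overhead_div (b : ℕ) :
    Tendsto (fun k : ℕ => ((Nat.log 2 (k * b + 1) + 1 : ℕ) + 1 : ℝ) / k) atTop (𝓝 0) := by
  have h1 : Tendsto (fun k : ℕ => (logb 2 (k * (b + 1)) + 2) / (k : ℝ)) atTop (𝓝 0) := by
    have h2 : Tendsto (fun k : ℕ => log k / (k : ℝ)) atTop (𝓝 0) :=
      (isLittleO_log_id_atTop.tendsto_div_nhds_zero).comp tendsto_natCast_atTop_atTop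
    have h3 : Tendsto (fun k : ℕ => (logb 2 (b + 1) + 2) / (k : ℝ)) atTop (𝓝 0) :=
      tendsto_const_div_atTop_nhds_zero_nat _
    have h4 := (h2.div_const (log 2)).add h3
    simp only [zero_div, add_zero] at h4
    refine h4.congr' ?_
    filter_upwards [eventually_gt_atTop 0] with k hk
    have : (k : ℝ) ≠ 0 := by positivity
    rw [logb_mul this (by positivity)]
    simp only [logb]
    ring
  refine squeeze_zero' (Eventually.of_forall fun k => by positivity) ?_ h1
  filter_upwards [eventually_gt_atTop 0] with k hk
  refine div_le_div_of_nonneg_right ?_ (Nat.cast_nonneg k)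
  have h5 : (Nat.log 2 (k * b + 1) : ℝ) ≤ logb 2 (k * (b + 1)) := by
    have h6 : (2 : ℝ) ^ (Nat.log 2 (k * b + 1)) ≤ k * (b + 1) := by
      have h7 := Nat.pow_log_le_self 2 (x := k * b + 1) (by omega)
      have h8 : k * b + 1 ≤ k * (b + 1) := by rw [mul_add]; omega
      exact_mod_cast h7.trans h8
    rw [le_logb_iff_rpow_le (by norm_num) (by positivity), rpow_natCast]
    exact h6
  push_cast
  linarith

/-- Block codes achieve the difference of the entropy rates. -/
lemma exists_blockCode (hm : Ergodic seqShift m) {c : ℝ}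
    (hc : (entropyRate m - entropyRate (fstMarginal m)) / log 2 < c) :
    ∃ k : ℕ, 0 < k ∧ ∃ enc : (Fin k → A) → (Fin k → B) → List Bool,
      (∀ a v v', enc a v <+: enc a v' → v = v') ∧ (∀ a v, enc a v ≠ []) ∧
      ∫ x, ((enc (Prod.fst ∘ initialWord k x) (Prod.snd ∘ initialWord k x)).length : ℝ) ∂m < c * k := by
  set b := Fintype.card B
  have hlim : Tendsto (fun k : ℕ => ((Nat.log 2 (k * b + 1) + 1 : ℕ) + 1 : ℝ) / k +
      (blockEntropy m k / k - blockEntropy (fstMarginal m) k / k) / log 2) atTop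
      (𝓝 (0 + (entropyRate m - entropyRate (fstMarginal m)) / log 2)) :=
    (tendsto_log_overhead_div b).add (((tendsto_blockEntropy_div hm.toMeasurePreserving).sub
      (tendsto_blockEntropy_div (ergodic_map_mapSeq hm Prod.fst).toMeasurePreserving)).div_const _)
  rw [zero_add] at hlim
  obtain ⟨k, hk, hk0⟩ := ((hlim.eventually (gt_mem_nhds hc)).and (eventually_gt_atTop 0)).exists
  refine ⟨k, hk0, ?_⟩
  -- The choice `N = k * b` rests on the crude bound `b ≤ 2 ^ b`; this is enough because `N` enters
  -- the lengths only through the logarithmic header.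
  choose enc h1 h2 h3 h4 using fun a : Fin k → A =>
    exists_prefixCode (V := Fin k → B) (p := fun v => wordProb m (pairWord a v))
      (fun v => wordProb_nonneg _) (sum_wordProb_pairWord a).le (N := k * b)
      (D := Nat.log 2 (k * b + 1) + 1)
      (by
        rw [Fintype.card_fun, Fintype.card_fin, mul_comm, pow_mul]
        exact Nat.pow_le_pow_left Nat.lt_two_pow_self.le _)
      (Nat.succ_pos _) (Nat.lt_pow_succ_log_self (by norm_num) _).le
  refine ⟨enc, h1, h2, (integral_length_le (D := Nat.log 2 (k * b + 1) + 1) h4).trans_lt ?_⟩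
  have hk' : (0 : ℝ) < k := by exact_mod_cast hk0
  have := (mul_lt_mul_iff_left₀ hk').2 hk
  refine lt_of_eq_of_lt ?_ this
  field_simp

/-- If the difference were negative, some block code would have a negative mean length. -/
lemma entropyRate_fstMarginal_le (hm : Ergodic seqShift m) :
    entropyRate (fstMarginal m) ≤ entropyRate m := by
  by_contra! h
  have h0 : (entropyRate m - entropyRate (fstMarginal m)) / log 2 < 0 :=
    div_neg_of_neg_of_pos (by linarith) (log_pos (by norm_num))
  obtain ⟨k, -, enc, -, -, hlt⟩ := exists_blockCode hm h0
  rw [zero_mul] at hlt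
  exact absurd (integral_nonneg fun x => Nat.cast_nonneg _) (not_le.2 hlt)

/-- The conditional complexity is bounded above by the difference of the entropy rates. -/
theorem eventually_condComplexity_le (hm : Ergodic seqShift m)
    {V : OracleMachine A B} (hV : V.IsUniversal) {c : ℝ}
    (hc : (entropyRate m - entropyRate (fstMarginal m)) / log 2 < c) :
    ∀ᵐ x ∂m, ∀ᶠ n : ℕ in atTop,
      (V.condComplexity ((List.range n).map (mapSeq Prod.snd x)) (mapSeq Prod.fst x) : ℝ≥0∞) ≤
        ENNReal.ofReal (c * n) := by
  -- The slack `c - c'` absorbs the additive constant `K / k`.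
  obtain ⟨c', hc', hcc'⟩ := exists_between hc
  obtain ⟨k, hk, enc, henc, hne, hlt⟩ := exists_blockCode hm hc'
  obtain ⟨K, hK⟩ := hV.exists_condComplexity_le_sum hk henc hne
  set L : (ℕ → A × B) → ℝ := fun x =>
    ((enc (Prod.fst ∘ initialWord k x) (Prod.snd ∘ initialWord k x)).length : ℝ)
  have hLm : Measurable L := (measurable_of_finite fun w : Fin k → A × B =>
    ((enc (Prod.fst ∘ w) (Prod.snd ∘ w)).length : ℝ)).comp (measurable_initialWord k)
  have hLi : Integrable L m := by
    have : IsProbabilityMeasure (m.map (initialWord k)) :=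
      Measure.isProbabilityMeasure_map (measurable_initialWord k).aemeasurable
    exact (integrable_map_measure (measurable_of_finite fun w : Fin k → A × B =>
      ((enc (Prod.fst ∘ w) (Prod.snd ∘ w)).length : ℝ)).aestronglyMeasurable
      (measurable_initialWord k).aemeasurable).1 Integrable.of_finite
  filter_upwards [hm.birkhoffSum_eventually_le hLm hLi hlt] with x hx
  have hk' : (0 : ℝ) < k := by exact_mod_cast hk
  have hev : ∀ᶠ n : ℕ in atTop, (K : ℝ) / k ≤ (c - c') * n :=
    (tendsto_natCast_atTop_atTop.const_mul_atTop (sub_pos.2 hcc')).eventually_ge_atTop _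
  filter_upwards [hx, hev] with n hn hn'
  obtain ⟨q, hq1, hq2⟩ := hK (mapSeq Prod.fst x) (mapSeq Prod.snd x) n
  have h1 : (k : ℝ) * q ≤ K + birkhoffSum seqShift L n x := by
    have h2 : ((k * q : ℕ) : ℝ) ≤ ((K + ∑ i ∈ Finset.range n,
      (enc (fun j => mapSeq Prod.fst x (j + i)) fun j => mapSeq Prod.snd x (j + i)).length : ℕ) : ℝ) := by
      exact_mod_cast hq2
    push_cast at h2
    refine h2.trans_eq ?_
    rw [birkhoffSum]
    congr 1
    refine Finset.sum_congr rfl fun i _ => ?_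
    rw [iterate_seqShift]
    rfl
  have h3 : (q : ℝ) ≤ c * n := by
    have h4 : (K : ℝ) ≤ (c - c') * n * k := (div_le_iff₀ hk').1 hn'
    have h5 : (k : ℝ) * q ≤ k * (c * n) := by nlinarith
    exact le_of_mul_le_mul_left h5 hk'
  calc (V.condComplexity ((List.range n).map (mapSeq Prod.snd x)) (mapSeq Prod.fst x) : ℝ≥0∞)
      ≤ ((q : ℕ∞) : ℝ≥0∞) := by exact_mod_cast hq1
    _ = ENNReal.ofReal q := by simp
    _ ≤ _ := ENNReal.ofReal_le_ofReal h3

end Pairs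

/-! ### Lower bound for the conditional complexity by counting -/

section LowerBound

open Real Topology

variable {A B : Type*} [Fintype A] [MeasurableSpace A] [DiscreteMeasurableSpace A]
  [Fintype B] [MeasurableSpace B] [DiscreteMeasurableSpace B] {m : Measure (ℕ → A × B)}
  [IsProbabilityMeasure m]

/-- The word formed by the first `n` second components is independent of the sequence of the first
components, conditioned on the word formed by the first `n` first components. -/
def IsNonanticipating (m : Measure (ℕ → A × B)) : Prop :=
  ∀ (n : ℕ) (a : Fin n → A) (v : Fin n → B) (D : Set (ℕ → A)), MeasurableSet D →
    m (initialWord n ⁻¹' {pairWord a v} ∩ mapSeq Prod.fst ⁻¹' D) *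
        fstMarginal m (initialWord n ⁻¹' {a}) =
      m (initialWord n ⁻¹' {pairWord a v}) * fstMarginal m (initialWord n ⁻¹' {a} ∩ D)

lemma sum_measure_cylinder_inter {n : ℕ} (ρ : Measure (ℕ → A)) {D : Set (ℕ → A)}
    (hD : MeasurableSet D) : ∑ a : Fin n → A, ρ (initialWord n ⁻¹' {a} ∩ D) = ρ D := by
  have hU : D = ⋃ a : Fin n → A, initialWord n ⁻¹' {a} ∩ D := by
    ext x; simp
  conv_rhs => rw [hU]
  rw [measure_iUnion, tsum_fintype]
  · intro a a' haa'
    exact (Disjoint.preimage _ (Set.disjoint_singleton.2 haa')).mono Set.inter_subset_left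
      Set.inter_subset_left
  · exact fun a => (measurable_initialWord n (measurableSet_singleton _)).inter hD

/-- Exchanging sum and integral reduces this to the count of words for a single oracle; the exchange
uses measurability in the oracle. -/
lemma sum_measure_condComplexity_le {n : ℕ} (ρ : Measure (ℕ → A)) [IsProbabilityMeasure ρ]
    (V : OracleMachine A B) (q : ℕ) :
    ∑ v : Fin n → B, ρ {α | V.condComplexity (List.ofFn v) α ≤ q} ≤ 2 ^ (q + 1) := by
  classical
  have hm : ∀ v : Fin n → B, MeasurableSet {α : ℕ → A | V.condComplexity (List.ofFn v) α ≤ q} :=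
    fun v => V.measurableSet_condComplexity_le _ _
  calc ∑ v : Fin n → B, ρ {α | V.condComplexity (List.ofFn v) α ≤ q}
      = ∫⁻ α, ∑ v : Fin n → B,
          {α | V.condComplexity (List.ofFn v) α ≤ q}.indicator (fun _ => (1 : ℝ≥0∞)) α ∂ρ := by
        rw [lintegral_finsetSum _ fun v _ => measurable_const.indicator (hm v)]
        refine Finset.sum_congr rfl fun v _ => ?_
        rw [lintegral_indicator (hm v)]
        simp
    _ ≤ ∫⁻ _, 2 ^ (q + 1) ∂ρ := by
        refine lintegral_mono fun α => ?_
        obtain ⟨hf, hc⟩ := V.finite_and_ncard_condComplexity_le α q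
        have h1 : ∑ v : Fin n → B,
            {α | V.condComplexity (List.ofFn v) α ≤ q}.indicator (fun _ => (1 : ℝ≥0∞)) α =
            ((Finset.univ.filter fun v : Fin n → B =>
              V.condComplexity (List.ofFn v) α ≤ q).card : ℝ≥0∞) := by
          rw [Finset.card_filter]
          push_cast
          exact Finset.sum_congr rfl fun v _ => by simp [Set.indicator]
        have h2 : (Finset.univ.filter fun v : Fin n → B =>
              V.condComplexity (List.ofFn v) α ≤ q).card ≤ 2 ^ (q + 1) := by
          refine le_trans ?_ hc
          rw [← Set.ncard_coe_finset]
          refine Set.ncard_le_ncard_of_injOn List.ofFn (fun v hv => by simpa using hv)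
            (List.ofFn_injective.injOn) hf
        simp only [h1]
        exact_mod_cast h2
    _ = 2 ^ (q + 1) := by simp

/-- The probability of a word that is both of small conditional complexity and of small conditional
probability. -/
lemma measure_condComplexity_le_and_wordProb_le (hm : IsNonanticipating m) (V : OracleMachine A B)
    (n q : ℕ) {δ : ℝ} (hδ : 0 ≤ δ) :
    m {x | V.condComplexity ((List.range n).map (mapSeq Prod.snd x)) (mapSeq Prod.fst x) ≤ q ∧
        wordProb m (initialWord n x) ≤
          δ * wordProb (fstMarginal m) (initialWord n (mapSeq Prod.fst x))} ≤
      ENNReal.ofReal δ * 2 ^ (q + 1) := by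
  classical
  set D : (Fin n → B) → Set (ℕ → A) := fun v => {α | V.condComplexity (List.ofFn v) α ≤ q} with hD
  have hDm : ∀ v, MeasurableSet (D v) := fun v => V.measurableSet_condComplexity_le _ _
  have hsub : {x | V.condComplexity ((List.range n).map (mapSeq Prod.snd x)) (mapSeq Prod.fst x) ≤ q ∧
        wordProb m (initialWord n x) ≤
          δ * wordProb (fstMarginal m) (initialWord n (mapSeq Prod.fst x))} ⊆
      ⋃ v : Fin n → B, ⋃ a : Fin n → A,
        if wordProb m (pairWord a v) ≤ δ * wordProb (fstMarginal m) a then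
          initialWord n ⁻¹' {pairWord a v} ∩ mapSeq Prod.fst ⁻¹' D v else ∅ := by
    rintro x ⟨h1, h2⟩
    simp only [Set.mem_iUnion]
    refine ⟨initialWord n (mapSeq Prod.snd x), initialWord n (mapSeq Prod.fst x), ?_⟩
    have h3 : pairWord (initialWord n (mapSeq Prod.fst x)) (initialWord n (mapSeq Prod.snd x)) =
        initialWord n x := rfl
    rw [h3, if_pos h2]
    refine ⟨rfl, ?_⟩
    rw [OracleMachine.map_range_eq_ofFn] at h1
    exact h1
  have hterm : ∀ v a, m (if wordProb m (pairWord a v) ≤ δ * wordProb (fstMarginal m) a then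
      initialWord n ⁻¹' {pairWord a v} ∩ mapSeq Prod.fst ⁻¹' D v else ∅) ≤
      ENNReal.ofReal δ * fstMarginal m (initialWord n ⁻¹' {a} ∩ D v) := by
    intro v a
    split_ifs with h
    · have hP : m (initialWord n ⁻¹' {pairWord a v}) ≤
          ENNReal.ofReal δ * fstMarginal m (initialWord n ⁻¹' {a}) := by
        have := ENNReal.ofReal_le_ofReal h
        rwa [ENNReal.ofReal_mul hδ, wordProb, wordProb, ofReal_measureReal, ofReal_measureReal]
          at this
      by_cases h0 : fstMarginal m (initialWord n ⁻¹' {a}) = 0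
      · rw [h0, mul_zero, nonpos_iff_eq_zero] at hP
        rw [measure_mono_null Set.inter_subset_left hP]
        exact zero_le
      -- Given `a`, the word `v` does not depend on the rest of the oracle, so the conditional
      -- probability of `v`, at most `δ`, splits off from the event `D v`. Clearing denominators
      -- requires the cylinder of `a` to have positive mass.
      · have h1 := hm n a v (D v) (hDm v)
        refine (ENNReal.mul_le_mul_iff_left h0 (measure_ne_top _ _)).1 ?_
        rw [h1]
        calc _ ≤ ENNReal.ofReal δ * fstMarginal m (initialWord n ⁻¹' {a}) *
              fstMarginal m (initialWord n ⁻¹' {a} ∩ D v) := mul_le_mul_left hP _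
          _ = _ := by ring
    · simp
  calc _ ≤ ∑ v : Fin n → B, ∑ a : Fin n → A,
        m (if wordProb m (pairWord a v) ≤ δ * wordProb (fstMarginal m) a then
          initialWord n ⁻¹' {pairWord a v} ∩ mapSeq Prod.fst ⁻¹' D v else ∅) :=
      (measure_mono hsub).trans ((measure_iUnion_fintype_le _ _).trans
        (Finset.sum_le_sum fun v _ => measure_iUnion_fintype_le _ _))
    _ ≤ ∑ v : Fin n → B, ∑ a : Fin n → A,
        ENNReal.ofReal δ * fstMarginal m (initialWord n ⁻¹' {a} ∩ D v) :=
      Finset.sum_le_sum fun v _ => Finset.sum_le_sum fun a _ => hterm v a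
    _ = ENNReal.ofReal δ * ∑ v : Fin n → B, fstMarginal m (D v) := by
      simp_rw [← Finset.mul_sum, sum_measure_cylinder_inter (fstMarginal m) (hDm _)]
    _ ≤ _ := mul_le_mul_right (sum_measure_condComplexity_le _ V q) _

/-- The conditional complexity of a word cannot be essentially smaller than its conditional
information. -/
theorem eventually_le_condComplexity_of_wordProb_le (hm : IsNonanticipating m)
    (V : OracleMachine A B) {s t : ℝ} (hst : t * log 2 < s) :
    ∀ᵐ x ∂m, ∀ᶠ n : ℕ in atTop,
      wordProb m (initialWord n x) ≤
        exp (-(s * n)) * wordProb (fstMarginal m) (initialWord n (mapSeq Prod.fst x)) →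
      ENNReal.ofReal (t * n) ≤
        (V.condComplexity ((List.range n).map (mapSeq Prod.snd x)) (mapSeq Prod.fst x) : ℝ≥0∞) := by
  by_cases ht : t ≤ 0
  · refine ae_of_all _ fun x => Eventually.of_forall fun n _ => ?_
    rw [ENNReal.ofReal_of_nonpos (mul_nonpos_of_nonpos_of_nonneg ht (Nat.cast_nonneg n))]
    exact zero_le
  push Not at ht
  set bad : ℕ → Set (ℕ → A × B) := fun n =>
    {x | V.condComplexity ((List.range n).map (mapSeq Prod.snd x)) (mapSeq Prod.fst x) ≤
        (⌊t * n⌋₊ : ℕ) ∧ wordProb m (initialWord n x) ≤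
      exp (-(s * n)) * wordProb (fstMarginal m) (initialWord n (mapSeq Prod.fst x))} with hbad
  -- About `2 ^ (t * n)` words compete, each of conditional probability at most `exp (-(s * n))`;
  -- the bounds are summable because `t * log 2 < s`.
  have hb : ∀ n, m (bad n) ≤ ENNReal.ofReal (2 * exp (t * log 2 - s) ^ n) := fun n => by
    refine (measure_condComplexity_le_and_wordProb_le hm V n ⌊t * n⌋₊ (exp_pos _).le).trans ?_
    have h1 : (2 : ℝ≥0∞) ^ (⌊t * n⌋₊ + 1) = ENNReal.ofReal (2 ^ (⌊t * n⌋₊ + 1)) := by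
      rw [ENNReal.ofReal_pow (by norm_num)]; norm_num
    rw [h1, ← ENNReal.ofReal_mul (exp_pos _).le]
    refine ENNReal.ofReal_le_ofReal ?_
    have h2 : (2 : ℝ) ^ ⌊t * n⌋₊ ≤ exp (t * n * log 2) := by
      rw [← rpow_natCast, rpow_def_of_pos (by norm_num), exp_le_exp, mul_comm]
      exact mul_le_mul_of_nonneg_right (Nat.floor_le (by positivity)) (log_nonneg (by norm_num))
    calc exp (-(s * n)) * 2 ^ (⌊t * n⌋₊ + 1) = 2 * (exp (-(s * n)) * 2 ^ ⌊t * n⌋₊) := by ring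
      _ ≤ 2 * (exp (-(s * n)) * exp (t * n * log 2)) := by gcongr
      _ = 2 * exp (t * log 2 - s) ^ n := by
        rw [← exp_add, ← exp_nat_mul]; ring_nf
  have hsum : ∑' n, m (bad n) ≠ ∞ := by
    refine ne_top_of_le_ne_top ?_ (ENNReal.tsum_le_tsum hb)
    rw [← ENNReal.ofReal_tsum_of_nonneg (fun n => by positivity)
      ((summable_geometric_of_lt_one (exp_pos _).le
        (by rw [exp_lt_one_iff]; linarith)).mul_left 2)]
    exact ENNReal.ofReal_ne_top
  filter_upwards [ae_eventually_notMem hsum] with x hx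
  filter_upwards [hx] with n hn hP
  have h1 : ¬ V.condComplexity ((List.range n).map (mapSeq Prod.snd x)) (mapSeq Prod.fst x) ≤
      (⌊t * n⌋₊ : ℕ) := fun h => hn ⟨h, hP⟩
  have h2 : ((⌊t * n⌋₊ + 1 : ℕ) : ℕ∞) ≤
      V.condComplexity ((List.range n).map (mapSeq Prod.snd x)) (mapSeq Prod.fst x) := by
    rw [Nat.cast_add, Nat.cast_one]
    exact Order.add_one_le_of_lt (not_le.1 h1)
  have h3 : (((⌊t * n⌋₊ + 1 : ℕ) : ℕ∞) : ℝ≥0∞) ≤ (V.condComplexity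
      ((List.range n).map (mapSeq Prod.snd x)) (mapSeq Prod.fst x) : ℝ≥0∞) := by
    exact_mod_cast h2
  refine le_trans ?_ h3
  rw [ENat.toENNReal_coe, ← ENNReal.ofReal_natCast]
  refine ENNReal.ofReal_le_ofReal ?_
  push_cast
  exact (Nat.lt_floor_add_one _).le

end LowerBound

/-! ### From eventual bounds to a limit -/

section Limits

open Topology

/-- The exceptional sets depend on the constants `c` and `t`; countably many constants, `h ± 1 / (j
+ 1)`, suffice. -/
lemma ae_tendsto_div_of_eventually {Ω : Type*} [MeasurableSpace Ω] {m : Measure Ω}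
    {u : Ω → ℕ → ℝ≥0∞} {h : ℝ}
    (hup : ∀ c, h < c → ∀ᵐ x ∂m, ∀ᶠ n : ℕ in atTop, u x n ≤ ENNReal.ofReal (c * n))
    (hlow : ∀ t, t < h → ∀ᵐ x ∂m, ∀ᶠ n : ℕ in atTop, ENNReal.ofReal (t * n) ≤ u x n) :
    ∀ᵐ x ∂m, Tendsto (fun n => u x n / n) atTop (𝓝 (ENNReal.ofReal h)) := by
  have h1 : ∀ᵐ x ∂m, ∀ j : ℕ, ∀ᶠ n : ℕ in atTop, u x n ≤ ENNReal.ofReal ((h + 1 / (j + 1)) * n) :=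
    ae_all_iff.2 fun j => hup _ (by linarith [Nat.one_div_pos_of_nat (α := ℝ) (n := j)])
  have h2 : ∀ᵐ x ∂m, ∀ j : ℕ, ∀ᶠ n : ℕ in atTop, ENNReal.ofReal ((h - 1 / (j + 1)) * n) ≤ u x n :=
    ae_all_iff.2 fun j => hlow _ (by linarith [Nat.one_div_pos_of_nat (α := ℝ) (n := j)])
  filter_upwards [h1, h2] with x hx1 hx2
  refine tendsto_order.2 ⟨fun a ha => ?_, fun b hb => ?_⟩
  · obtain ⟨r, hr, har, hrh⟩ := ENNReal.lt_iff_exists_real_btwn.1 ha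
    have hrh' := (ENNReal.ofReal_lt_ofReal_iff_of_nonneg hr).1 hrh
    obtain ⟨j, hj⟩ := exists_nat_one_div_lt (sub_pos.2 hrh')
    filter_upwards [hx2 j, eventually_gt_atTop 0] with n hn hn0
    refine har.trans_le ?_
    rw [ENNReal.le_div_iff_mul_le (Or.inl (by simpa using hn0.ne')) (Or.inl (by simp))]
    refine le_trans ?_ hn
    rw [← ENNReal.ofReal_natCast, ← ENNReal.ofReal_mul hr]
    exact ENNReal.ofReal_le_ofReal (mul_le_mul_of_nonneg_right (by linarith) (Nat.cast_nonneg n))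
  · obtain ⟨r, hr, har, hrh⟩ := ENNReal.lt_iff_exists_real_btwn.1 hb
    have hr' : h < r := (ENNReal.ofReal_lt_ofReal_iff'.1 har).1
    obtain ⟨j, hj⟩ := exists_nat_one_div_lt (sub_pos.2 hr')
    filter_upwards [hx1 j, eventually_gt_atTop 0] with n hn hn0
    refine lt_of_le_of_lt ?_ hrh
    rw [ENNReal.div_le_iff_le_mul (Or.inl (by simpa using hn0.ne')) (Or.inl (by simp))]
    refine hn.trans ?_
    rw [← ENNReal.ofReal_natCast, ← ENNReal.ofReal_mul hr]
    exact ENNReal.ofReal_le_ofReal (mul_le_mul_of_nonneg_right (by linarith) (Nat.cast_nonneg n))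

end Limits

/-! ### Brudno's theorem and the upper half of Shannon-McMillan-Breiman -/

section Unconditional

open Real Topology

lemma wordProb_unit (ρ : Measure (ℕ → Unit)) [IsProbabilityMeasure ρ] {n : ℕ} (w : Fin n → Unit) :
    wordProb ρ w = 1 := by
  have h : initialWord n ⁻¹' {w} = Set.univ := by
    ext x; simp [Subsingleton.elim (initialWord n x) w]
  rw [wordProb, h]; simp

lemma entropyRate_unit {ρ : Measure (ℕ → Unit)} [IsProbabilityMeasure ρ]
    (hρ : MeasurePreserving seqShift ρ ρ) : entropyRate ρ = 0 := by
  refine tendsto_nhds_unique (tendsto_blockEntropy_div hρ) ?_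
  simp [blockEntropy, wordProb_unit]

/-- There is only one sequence over `Unit`, so `D` is empty or everything. -/
lemma isNonanticipating_of_unit {B : Type*} [Fintype B] [MeasurableSpace B]
    [DiscreteMeasurableSpace B] (m : Measure (ℕ → Unit × B)) : IsNonanticipating m := by
  intro n a v D _
  rcases D.eq_empty_or_nonempty with rfl | ⟨y, hy⟩
  · simp
  · have hD : D = Set.univ := by
      ext z; simp [Subsingleton.elim z y, hy]
    rw [hD]; simp

variable {A : Type*} [Fintype A] [MeasurableSpace A] [DiscreteMeasurableSpace A]
  {m : Measure (ℕ → A)} [IsProbabilityMeasure m]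

/-- The process with an additional trivial component. -/
noncomputable abbrev unitPairing (m : Measure (ℕ → A)) : Measure (ℕ → Unit × A) :=
  m.map (mapSeq (Equiv.punitProd A).symm)

lemma ae_of_ae_unitPairing {p : (ℕ → Unit × A) → Prop} (h : ∀ᵐ x ∂unitPairing m, p x) :
    ∀ᵐ x ∂m, p (mapSeq (Equiv.punitProd A).symm x) :=
  ae_of_ae_map (measurable_mapSeq _).aemeasurable h

lemma wordProb_unitPairing {n : ℕ} (x : ℕ → A) :
    wordProb (unitPairing m) (initialWord n (mapSeq (Equiv.punitProd A).symm x)) =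
      wordProb m (initialWord n x) :=
  wordProb_map_equiv (Equiv.punitProd A).symm (initialWord n x)

theorem eventually_complexity_le (hm : Ergodic seqShift m) {U : TuringMachine A}
    (hU : U.IsUniversal) {c : ℝ} (hc : entropyRate m / log 2 < c) :
    ∀ᵐ x ∂m, ∀ᶠ n : ℕ in atTop,
      (TuringMachine.complexity U ((List.range n).map x) : ℝ≥0∞) ≤ ENNReal.ofReal (c * n) := by
  have hm' : Ergodic seqShift (unitPairing m) := ergodic_map_mapSeq hm _
  have h := eventually_condComplexity_le hm' hU (c := c) (by
    rw [entropyRate_unit (ergodic_map_mapSeq hm' Prod.fst).toMeasurePreserving, sub_zero,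
      entropyRate_map_equiv hm.toMeasurePreserving]
    exact hc)
  exact ae_of_ae_unitPairing h

/-- The smallness of the cylinder is kept as a premise in order to use it twice: with the decay of
cylinder probabilities it bounds the complexity from below, and by contraposition, with the coding
bound, it yields a lower bound on those probabilities. -/
lemma eventually_le_complexity_of_wordProb_le (U : TuringMachine A) {s t : ℝ}
    (hst : t * log 2 < s) :
    ∀ᵐ x ∂m, ∀ᶠ n : ℕ in atTop, wordProb m (initialWord n x) ≤ exp (-(s * n)) →
      ENNReal.ofReal (t * n) ≤ (TuringMachine.complexity U ((List.range n).map x) : ℝ≥0∞) := by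
  have h := ae_of_ae_unitPairing (eventually_le_condComplexity_of_wordProb_le
    (isNonanticipating_of_unit (unitPairing m)) U hst)
  filter_upwards [h] with x hx
  filter_upwards [hx] with n hn hP
  rw [wordProb_unit, mul_one, wordProb_unitPairing] at hn
  exact hn hP

theorem eventually_le_complexity (hm : Ergodic seqShift m) (U : TuringMachine A) {t : ℝ}
    (ht : t < entropyRate m / log 2) :
    ∀ᵐ x ∂m, ∀ᶠ n : ℕ in atTop,
      ENNReal.ofReal (t * n) ≤ (TuringMachine.complexity U ((List.range n).map x) : ℝ≥0∞) := by
  rw [lt_div_iff₀ (log_pos (by norm_num))] at ht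
  obtain ⟨s, hts, hs⟩ := exists_between ht
  filter_upwards [eventually_wordProb_le_exp hm hs,
    eventually_le_complexity_of_wordProb_le U hts] with x h1 h2
  filter_upwards [h1, h2] with n hn1 hn2 using hn2 hn1

/-- The upper bound of the Shannon-McMillan-Breiman theorem. -/
theorem eventually_exp_le_wordProb (hm : Ergodic seqShift m) {U : TuringMachine A}
    (hU : U.IsUniversal) {s : ℝ} (hs : entropyRate m < s) :
    ∀ᵐ x ∂m, ∀ᶠ n : ℕ in atTop, exp (-(s * n)) ≤ wordProb m (initialWord n x) := by
  have hl : 0 < log 2 := log_pos (by norm_num)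
  -- With `c < t` between the two rates in bits, a cylinder of probability below `exp (-(s * n))`
  -- would force complexity at least `t * n`, against the coding bound `c * n`.
  obtain ⟨c, hc, hcs⟩ := exists_between ((div_lt_div_iff_of_pos_right hl).2 hs)
  obtain ⟨t, hct, hts⟩ := exists_between hcs
  filter_upwards [eventually_complexity_le hm hU hc,
    eventually_le_complexity_of_wordProb_le (m := m) U ((lt_div_iff₀ hl).1 hts)] with x h1 h2
  filter_upwards [h1, h2, eventually_gt_atTop 0] with n hn1 hn2 hn0
  by_contra! hlt
  have h3 := (hn2 hlt.le).trans hn1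
  have hn : (0 : ℝ) < n := by exact_mod_cast hn0
  have hc0 : 0 < c := lt_of_le_of_lt (div_nonneg entropyRate_nonneg hl.le) hc
  rw [ENNReal.ofReal_le_ofReal_iff (by positivity)] at h3
  exact absurd (lt_of_mul_lt_mul_right (h3.trans_lt (mul_lt_mul_of_pos_right hct hn)) hn.le)
    (lt_irrefl _)

/-- Brudno's theorem: the complexity of almost every sequence of an ergodic process equals its
entropy rate. -/
theorem ae_tendsto_complexity_div (hm : Ergodic seqShift m) {U : TuringMachine A}
    (hU : U.IsUniversal) :
    ∀ᵐ x ∂m, Tendsto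
      (fun n : ℕ => (TuringMachine.complexity U ((List.range n).map x) : ℝ≥0∞) / n) atTop
      (𝓝 (ENNReal.ofReal (entropyRate m / log 2))) :=
  ae_tendsto_div_of_eventually (fun _ hc => eventually_complexity_le hm hU hc)
    fun _ ht => eventually_le_complexity hm U ht

end Unconditional

/-! ### Conditional complexity as a difference of entropy rates -/

section Conditional

open Real Topology

variable {A B : Type*} [Fintype A] [MeasurableSpace A] [DiscreteMeasurableSpace A]
  [Fintype B] [MeasurableSpace B] [DiscreteMeasurableSpace B] {m : Measure (ℕ → A × B)}
  [IsProbabilityMeasure m]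

/-- Joint cylinders have probability at most `exp (-(r * n))` and base cylinders at least `exp (-((r
- s) * n))`, so the conditional probability is at most `exp (-(s * n))`. The machine `W` enters
through the estimate for the base. -/
theorem eventually_le_condComplexity (hm : Ergodic seqShift m) (hn : IsNonanticipating m)
    (V : OracleMachine A B) {W : TuringMachine A} (hW : W.IsUniversal) {t : ℝ}
    (ht : t < (entropyRate m - entropyRate (fstMarginal m)) / log 2) :
    ∀ᵐ x ∂m, ∀ᶠ n : ℕ in atTop, ENNReal.ofReal (t * n) ≤
      (V.condComplexity ((List.range n).map (mapSeq Prod.snd x)) (mapSeq Prod.fst x) : ℝ≥0∞) := by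
  rw [lt_div_iff₀ (log_pos (by norm_num))] at ht
  obtain ⟨s, hts, hs⟩ := exists_between ht
  obtain ⟨r, hr1, hr2⟩ := exists_between (lt_sub_iff_add_lt'.1 hs)
  have hbase := ae_of_ae_map (measurable_mapSeq Prod.fst).aemeasurable
    (eventually_exp_le_wordProb (ergodic_map_mapSeq hm Prod.fst) hW
      (s := r - s) (by linarith))
  filter_upwards [eventually_wordProb_le_exp hm hr2, hbase,
    eventually_le_condComplexity_of_wordProb_le hn V hts] with x h1 h2 h3
  filter_upwards [h1, h2, h3] with n hn1 hn2 hn3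
  refine hn3 (hn1.trans ?_)
  calc exp (-(r * n)) = exp (-(s * n)) * exp (-((r - s) * n)) := by rw [← exp_add]; ring_nf
    _ ≤ _ := mul_le_mul_of_nonneg_left hn2 (exp_pos _).le

/-- The conditional complexity of almost every sequence is the difference of the entropy rates. -/
theorem ae_tendsto_condComplexity_div (hm : Ergodic seqShift m) (hn : IsNonanticipating m)
    {V : OracleMachine A B} (hV : V.IsUniversal) {W : TuringMachine A} (hW : W.IsUniversal) :
    ∀ᵐ x ∂m, Tendsto (fun n : ℕ => (V.condComplexity ((List.range n).map (mapSeq Prod.snd x))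
      (mapSeq Prod.fst x) : ℝ≥0∞) / n) atTop
      (𝓝 (ENNReal.ofReal ((entropyRate m - entropyRate (fstMarginal m)) / log 2))) :=
  ae_tendsto_div_of_eventually (fun _ hc => eventually_condComplexity_le hm hV hc)
    fun _ ht => eventually_le_condComplexity hm hn V hW ht

end Conditional

/-! ### Names of the skew product as an ergodic process -/

section Names

variable {Θ X ι : Type*}

lemma iterate_skewProduct (T : Θ → X → X) (n : ℕ) (p : (ℕ → Θ) × X) :
    (skewProduct T)^[n] p = (fun j => p.1 (j + n), fiberIterate T p.1 n p.2) := by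
  induction n with
  | zero => rfl
  | succ n ih =>
    rw [Function.iterate_succ_apply', ih]
    simp only [skewProduct, fiberIterate, Function.comp_apply, Nat.zero_add]
    refine Prod.ext (funext fun j => ?_) rfl
    change p.1 (j + 1 + n) = p.1 (j + (n + 1))
    rw [add_assoc, add_comm 1]

/-- A finite partition is given by a measurable labelling outside a null set. -/
lemma IsFinitePartition.exists_labelling [MeasurableSpace X] [MeasurableSpace ι]
    [DiscreteMeasurableSpace ι] {μ : Measure X} [IsProbabilityMeasure μ] {P : ι → Set X}
    (hP : IsFinitePartition μ P) :
    ∃ φ : X → ι, Measurable φ ∧ ∀ᵐ x ∂μ, ∀ i, x ∈ P i ↔ φ x = i := by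
  classical
  have := hP.finite
  have hne : Nonempty ι := by
    obtain ⟨_, i, _⟩ := hP.cover.exists
    exact ⟨i⟩
  -- Cells may overlap or miss points on a null set, so the label is the unique cell on `G` and
  -- arbitrary elsewhere.
  set G : Set X := {x | ∃! i, x ∈ P i} with hG
  have hGm : MeasurableSet G := by
    have : G = ⋃ i, (P i ∩ ⋂ j : {j // j ≠ i}, (P j)ᶜ) := by
      ext x
      simp only [hG, Set.mem_ofPred_eq, Set.mem_iUnion, Set.mem_inter_iff, Set.mem_iInter,
        Set.mem_compl_iff, Subtype.forall, ExistsUnique]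
      exact exists_congr fun i => and_congr_right fun _ =>
        forall_congr' fun j => ⟨fun h hne hj => hne (h hj), fun h hj => by_contra fun hne => h hne hj⟩
    rw [this]
    exact MeasurableSet.iUnion fun i => (hP.measurableSet i).inter
      (MeasurableSet.iInter fun j => (hP.measurableSet j).compl)
  set φ : X → ι := fun x => if h : ∃! i, x ∈ P i then h.choose else Classical.arbitrary ι with hφ
  have hφG : ∀ x ∈ G, ∀ i, x ∈ P i ↔ φ x = i := by
    intro x hx i
    have h1 : φ x = hx.choose := dif_pos hx
    rw [h1]
    exact ⟨fun h => (hx.choose_spec.2 i h).symm, fun h => h ▸ hx.choose_spec.1⟩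
  refine ⟨φ, measurable_to_countable' fun i => ?_, ?_⟩
  · have : φ ⁻¹' {i} = (P i ∩ G) ∪ (if Classical.arbitrary ι = i then Gᶜ else ∅) := by
      ext x
      by_cases hx : x ∈ G
      · have := hφG x hx i
        split_ifs <;> simp [hx, this]
      · have h1 : φ x = Classical.arbitrary ι := dif_neg hx
        split_ifs with h <;> simp [hx, h1, h]
    rw [this]
    refine ((hP.measurableSet i).inter hGm).union ?_
    split_ifs
    exacts [hGm.compl, MeasurableSet.empty]
  · have hdis : ∀ᵐ x ∂μ, ∀ i j, i ≠ j → ¬(x ∈ P i ∧ x ∈ P j) := by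
      refine ae_all_iff.2 fun i => ae_all_iff.2 fun j => ?_
      by_cases hij : i = j
      · exact ae_of_all _ fun x h => absurd hij h
      · filter_upwards [measure_eq_zero_iff_ae_notMem.1 (hP.aedisjoint hij)] with x hx _ using hx
    filter_upwards [hP.cover, hdis] with x ⟨i, hi⟩ hx
    exact hφG x ⟨i, hi, fun j hj => by_contra fun hne => hx j i hne ⟨hj, hi⟩⟩

/-- The name of a point with respect to the natural partition and a labelling of the fibre. -/
def jointName (T : Θ → X → X) (φ : X → ι) (p : (ℕ → Θ) × X) : ℕ → Θ × ι :=
  fun n => (p.1 n, φ (fiberIterate T p.1 n p.2))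

lemma fiberIterate_congr (T : Θ → X → X) {α β : ℕ → Θ} {n : ℕ} (h : ∀ i < n, α i = β i) :
    fiberIterate T α n = fiberIterate T β n := by
  induction n with
  | zero => rfl
  | succ n ih =>
    rw [fiberIterate, fiberIterate, ih fun i hi => h i (hi.trans n.lt_succ_self),
      h n n.lt_succ_self]

lemma jointName_semiconj (T : Θ → X → X) (φ : X → ι) :
    Function.Semiconj (jointName T φ) (skewProduct T) seqShift := by
  intro p
  funext n
  have h1 := iterate_skewProduct T n (skewProduct T p)
  have h2 := iterate_skewProduct T (n + 1) p
  rw [Function.iterate_succ_apply] at h2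
  have h3 := congrArg Prod.snd (h1.symm.trans h2)
  simp only at h3
  simp only [jointName, seqShift, h3]
  rfl

variable [Fintype Θ] [MeasurableSpace Θ] [DiscreteMeasurableSpace Θ] [MeasurableSpace X]
  [Fintype ι] [MeasurableSpace ι] [DiscreteMeasurableSpace ι]

lemma measurable_jointName {T : Θ → X → X} (hT : Measurable (skewProduct T)) {φ : X → ι}
    (hφ : Measurable φ) : Measurable (jointName T φ) := by
  refine measurable_pi_lambda _ fun n => ?_
  have h1 : (fun p : (ℕ → Θ) × X => jointName T φ p n) =
      (fun p => (p.1 0, φ p.2)) ∘ (skewProduct T)^[n] := by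
    funext p
    simp [jointName, iterate_skewProduct]
  rw [h1]
  exact (((measurable_pi_apply (X := fun _ : ℕ => Θ) 0).comp measurable_fst).prodMk
    (hφ.comp measurable_snd)).comp (hT.iterate n)

/-- The maps `fiberIterate T α i` with `i < n` involve only the letters of `α` before position `n`.
Hence a cylinder of names of length `n` pulls back to the product of a cylinder of `α` with a set
`R` of fibre points, and the product measure factorizes. -/
lemma isNonanticipating_map_jointName {ν : Measure (ℕ → Θ)} {μ : Measure X}
    [IsProbabilityMeasure ν] [IsProbabilityMeasure μ] {T : Θ → X → X}
    (hT : Measurable (skewProduct T)) {φ : X → ι} (hφ : Measurable φ) :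
    IsNonanticipating ((ν.prod μ).map (jointName T φ)) := by
  have hJ := measurable_jointName hT hφ
  have hfst : fstMarginal ((ν.prod μ).map (jointName T φ)) = ν := by
    rw [fstMarginal, Measure.map_map (measurable_mapSeq _) hJ]
    have : mapSeq Prod.fst ∘ jointName T φ = Prod.fst := rfl
    rw [this, Measure.map_fst_prod]
    simp
  intro n a v D hD
  rw [hfst]
  have hC : MeasurableSet (initialWord (A := Θ × ι) n ⁻¹' {pairWord a v}) :=
    measurable_initialWord n (measurableSet_singleton _)
  have hprod : ∃ R : Set X, ∀ D : Set (ℕ → Θ),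
      jointName T φ ⁻¹' (initialWord n ⁻¹' {pairWord a v} ∩ mapSeq Prod.fst ⁻¹' D) =
        (initialWord n ⁻¹' {a} ∩ D) ×ˢ R := by
    by_cases hα : ∃ β : ℕ → Θ, initialWord n β = a
    · obtain ⟨β, rfl⟩ := hα
      refine ⟨{x | ∀ i : Fin n, φ (fiberIterate T β i x) = v i}, fun D => ?_⟩
      ext ⟨α, x⟩
      simp only [Set.mem_preimage, Set.mem_inter_iff, Set.mem_singleton_iff, Set.mem_prod,
        Set.mem_ofPred_eq]
      have h1 : mapSeq Prod.fst (jointName T φ (α, x)) = α := rfl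
      rw [h1]
      have h2 : initialWord n (jointName T φ (α, x)) = pairWord (initialWord n β) v ↔
          initialWord n α = initialWord n β ∧ ∀ i : Fin n, φ (fiberIterate T α i x) = v i := by
        rw [funext_iff, funext_iff, ← forall_and]
        exact forall_congr' fun i => Prod.ext_iff
      rw [h2]
      have h3 : initialWord n α = initialWord n β →
          ∀ i : Fin n, fiberIterate T α i = fiberIterate T β i := fun h i =>
        fiberIterate_congr T fun j hj => congrFun h ⟨j, hj.trans i.2⟩
      constructor
      · rintro ⟨⟨h4, h5⟩, h6⟩
        exact ⟨⟨h4, h6⟩, fun i => by rw [← h3 h4]; exact h5 i⟩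
      · rintro ⟨⟨h4, h6⟩, h5⟩
        exact ⟨⟨h4, fun i => by rw [h3 h4]; exact h5 i⟩, h6⟩
    · refine ⟨∅, fun D => ?_⟩
      rw [Set.prod_empty, Set.eq_empty_iff_forall_notMem]
      rintro ⟨α, x⟩ ⟨h1, -⟩
      have h1' : initialWord n (jointName T φ (α, x)) = pairWord a v := h1
      exact hα ⟨α, funext fun i => congrArg Prod.fst (congrFun h1' i)⟩
  obtain ⟨R, hR⟩ := hprod
  have hR' : jointName T φ ⁻¹' (initialWord n ⁻¹' {pairWord a v}) = (initialWord n ⁻¹' {a}) ×ˢ R := by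
    simpa using hR Set.univ
  rw [Measure.map_apply hJ (hC.inter (measurable_mapSeq _ hD)), Measure.map_apply hJ hC, hR, hR',
    Measure.prod_prod, Measure.prod_prod]
  ring

end Names

/-! ### The complexity formula -/

theorem theorem3 {Θ X ι : Type*}
    [Finite Θ] [MeasurableSpace Θ] [DiscreteMeasurableSpace Θ] [MeasurableSpace X]
    (ν : Measure (ℕ → Θ)) [IsProbabilityMeasure ν]
    (μ : Measure X) [IsProbabilityMeasure μ]
    (T : Θ → X → X) (hRDS : IsFiniteBundleRDS ν μ T)
    (hT : Ergodic (skewProduct T) (ν.prod μ))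
    (P : ι → Set X) (hP : IsFinitePartition μ P)
    (U : TuringMachine (Θ × ι)) (hU : U.IsUniversal)
    (V : OracleMachine Θ ι) (hV : V.IsUniversal)
    (W : TuringMachine Θ) (hW : W.IsUniversal) :
    ∀ᵐ p ∂(ν.prod μ), ∃ (τ : ℕ → Θ × ι) (ω : ℕ → ι),
      IsName (skewProduct T) (naturalProd P) p τ ∧
      IsFiberName T P p.1 p.2 ω ∧
      ∃ cJoint cCond cBase : ℝ≥0,
        (TuringMachine.upperComplexity U τ = cJoint ∧
          TuringMachine.lowerComplexity U τ = cJoint) ∧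
        (V.upperCondComplexity ω p.1 = cCond ∧ V.lowerCondComplexity ω p.1 = cCond) ∧
        (TuringMachine.upperComplexity W p.1 = cBase ∧
          TuringMachine.lowerComplexity W p.1 = cBase) ∧
        (cCond : ℝ) = (cJoint : ℝ) - (cBase : ℝ) := by
  have := hP.finite
  have := Fintype.ofFinite Θ
  have := Fintype.ofFinite ι
  let _ : MeasurableSpace ι := ⊤
  obtain ⟨φ, hφ, hφP⟩ := hP.exists_labelling
  have hJ := measurable_jointName hT.measurable hφ
  set m := (ν.prod μ).map (jointName T φ) with hm
  have : IsProbabilityMeasure m := Measure.isProbabilityMeasure_map hJ.aemeasurable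
  have hme : Ergodic seqShift m := (hJ.measurePreserving (ν.prod μ)).ergodic_of_ergodic_semiconj hT
    measurable_seqShift (jointName_semiconj T φ)
  have hfst : fstMarginal m = ν := by
    rw [fstMarginal, hm, Measure.map_map (measurable_mapSeq _) hJ]
    have : mapSeq Prod.fst ∘ jointName T φ = Prod.fst := rfl
    rw [this, Measure.map_fst_prod]
    simp
  have hna : IsNonanticipating m := isNonanticipating_map_jointName hT.measurable hφ
  have hlog : 0 < Real.log 2 := Real.log_pos (by norm_num)
  have hle := entropyRate_fstMarginal_le hme
  have hcond := ae_of_ae_map hJ.aemeasurable (ae_tendsto_condComplexity_div hme hna hV hW)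
  rw [hfst] at hle hcond
  have hlabel : ∀ᵐ p ∂(ν.prod μ), ∀ n, ∀ i,
      fiberIterate T p.1 n p.2 ∈ P i ↔ φ (fiberIterate T p.1 n p.2) = i := by
    have h1 : ∀ᵐ p ∂(ν.prod μ), ∀ i, p.2 ∈ P i ↔ φ p.2 = i :=
      Measure.quasiMeasurePreserving_snd.ae hφP
    refine ae_all_iff.2 fun n => ?_
    -- The labelling is faithful off a null set, and the iterates preserve the measure, so it is
    -- faithful along almost every orbit.
    have h2 := (hT.toMeasurePreserving.iterate n).quasiMeasurePreserving.ae h1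
    filter_upwards [h2] with p hp
    rw [iterate_skewProduct] at hp
    exact hp
  filter_upwards [hlabel, ae_of_ae_map hJ.aemeasurable (ae_tendsto_complexity_div hme hU), hcond,
    Measure.quasiMeasurePreserving_fst.ae (ae_tendsto_complexity_div hRDS.base_ergodic hW)]
    with p hp hlimJ hlimC hlimB
  refine ⟨jointName T φ p, mapSeq Prod.snd (jointName T φ p), ⟨fun n => ?_, fun τ hτ => ?_⟩,
    ⟨fun n => (hp n _).2 rfl, fun ω hω => funext fun n => ((hp n _).1 (hω n)).symm⟩,
    (entropyRate m / Real.log 2).toNNReal, ((entropyRate m - entropyRate ν) / Real.log 2).toNNReal,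
    (entropyRate ν / Real.log 2).toNNReal,
    ⟨hlimJ.limsup_eq, hlimJ.liminf_eq⟩, ⟨hlimC.limsup_eq, hlimC.liminf_eq⟩,
    ⟨hlimB.limsup_eq, hlimB.liminf_eq⟩, ?_⟩
  · rw [iterate_skewProduct]
    refine ⟨?_, (hp n _).2 rfl⟩
    simp [naturalPartition, jointName]
  · funext n
    have h := hτ n
    rw [iterate_skewProduct] at h
    have h1 : p.1 (0 + n) = (τ n).1 := h.1
    rw [Nat.zero_add] at h1
    exact Prod.ext h1.symm ((hp n _).1 h.2).symm
  -- Passing to `toNNReal` loses nothing since all three rates are nonnegative; for the difference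
  -- this is `entropyRate_fstMarginal_le`.
  · rw [Real.coe_toNNReal _ (div_nonneg (by linarith) hlog.le),
      Real.coe_toNNReal _ (div_nonneg entropyRate_nonneg hlog.le),
      Real.coe_toNNReal _ (div_nonneg entropyRate_nonneg hlog.le), sub_div]
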